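/- Let $Q$ be a finite quiver without loops, let $\mathcal{P}(Q)=\mathbb{C}\overline{Q}/\big(\sum_{a\in Q_1}(aa^*-a^*a)\big)$ be its preprojective algebra, where $\overline{Q}$ is the double quiver of $Q$, obtained by adding an opposite arrow $a^*$ for every arrow $a$ of $Q$. Let $\mathcal{A}=\mathcal{P}(Q)\text{-nil}$ be the abelian category of finite-dimensional nilpotent left $\mathcal{P}(Q)$-modules, i.e. of those having a composition series all of whose factors are among the one-dimensional simple modules $S_i$ attached to the vertices $i\in Q_0$. A central charge on $\mathcal{A}$ is a group homomorphism $Z:K(\mathcal{A})\to\mathbb{C}$ on the Grothendieck group such that for every nonzero $E\in\mathcal{A}$ one has $Z(E)=r\exp(i\pi\phi(E))$ with $r>0$ and $0<\phi(E)\le 1$; the number $\phi(E)$ is the phase of $E$. A nonzero object $E$ is stable if $\phi(A)<\phi(E)$ for every proper subobject $0\neq A\subset E$. The central charge $Z$ is discrete if non-isomorphic stable objects have different phases. Let $\mathcal{D}$ be any triangulated category with a bounded t-structure whose heart is (identified with) $\mathcal{A}$. A heart of a bounded t-structure on $\mathcal{D}$ is algebraic if it is of finite length and has finitely many simple objects up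 to isomorphism. If $S$ is a simple object of an algebraic heart $\mathcal{B}$ and $\langle S\rangle$ is its extension closure, then $\langle S\rangle$ is the torsion class of a torsion pair in $\mathcal{B}$ with torsion-free class $\mathcal{F}=\{E\in\mathcal{B}\mid \mathrm{Hom}(S,E)=0\}$; the simple (left) tilt $\mathcal{B}_S$ is the heart of a bounded t-structure consisting of all $E\in\mathcal{D}$ whose cohomology objects with respect to $\mathcal{B}$ satisfy $H^0(E)\in\mathcal{F}$, $H^1(E)\in\langle S\rangle$ and $H^i(E)=0$ for $i\neq 0,1$. A maximal green sequence of $\mathcal{A}$ (in $\mathcal{D}$), tilting at $E_1,\dots,E_m$, is a sequence $\mathcal{A}=\mathcal{A}_0,\mathcal{A}_1,\dots,\mathcal{A}_m=\mathcal{A}[-1]$ of hearts of bounded t-structures on $\mathcal{D}$, all algebraic with the same number of simple objects, such that for each $k=1,\dots,m$ the object $E_k$ lies in $\mathcal{A}$, is a simple object of $\mathcal{A}_{k-1}$, and $\mathcal{A}_k$ is the simple tilt $(\mathcal{A}_{k-1})_{E_k}$. Proposition. Let $Z$ be a discrete central charge on $\mathcal{A}=\mathcal{P}(Q)\text{-nil}$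 with only finitely many stable objects up to isomorphism. Then the stable objects can be listed (each isomorphism class once) in order of strictly decreasing phase as $E_1,\dots,E_m$, and for every such list and every $\mathcal{D}$ as above, the successive simple tilts at $E_1,\dots,E_m$ form a maximal green sequence of $\mathcal{A}$. -/

import Mathlib

open CategoryTheory CategoryTheory.Limits CategoryTheory.Pretriangulated
open CategoryTheory.Triangulated

universe u v w u' v'

noncomputable section

/-! ### Path algebras and preprojective algebras -/

section Algebras

/-- Generators of the path algebra of a quiver: a trivial path for each vertex, and the arrows. -/
inductive PathGen (W : Type u) [Quiver.{v} W] : Type (max u v)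
  | vertex (i : W) : PathGen W
  | arrow {i j : W} (a : i ⟶ j) : PathGen W

/-- Relations of the path algebra. Paths compose like functions: for `a : i ⟶ j` one has
`e_j * a = a = a * e_i`, and the product `b * a` is the path "first `a`, then `b`". The product of
two arrows that cannot be composed vanishes by `idem`, `orth`, `head` and `tail`. -/
inductive PathRel (W : Type u) [Fintype W] [Quiver.{v} W] :
    FreeAlgebra ℂ (PathGen W) → FreeAlgebra ℂ (PathGen W) → Prop
  | idem (i : W) : PathRel W
      (FreeAlgebra.ι ℂ (PathGen.vertex i) * FreeAlgebra.ι ℂ (PathGen.vertex i))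
      (FreeAlgebra.ι ℂ (PathGen.vertex i))
  | orth (i j : W) (h : i ≠ j) : PathRel W
      (FreeAlgebra.ι ℂ (PathGen.vertex i) * FreeAlgebra.ι ℂ (PathGen.vertex j)) 0
  | one : PathRel W (∑ i : W, FreeAlgebra.ι ℂ (PathGen.vertex i)) 1
  | head {i j : W} (a : i ⟶ j) : PathRel W
      (FreeAlgebra.ι ℂ (PathGen.vertex j) * FreeAlgebra.ι ℂ (PathGen.arrow a))
      (FreeAlgebra.ι ℂ (PathGen.arrow a))
  | tail {i j : W} (a : i ⟶ j) : PathRel W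
      (FreeAlgebra.ι ℂ (PathGen.arrow a) * FreeAlgebra.ι ℂ (PathGen.vertex i))
      (FreeAlgebra.ι ℂ (PathGen.arrow a))

/-- The complex path algebra of a quiver with finitely many vertices. -/
def PathAlgebra (W : Type u) [Fintype W] [Quiver.{v} W] : Type (max u v) :=
  RingQuot (PathRel W)

instance PathAlgebra.instRing (W : Type u) [Fintype W] [Quiver.{v} W] :
    Ring (PathAlgebra W) := inferInstanceAs (Ring (RingQuot (PathRel W)))

instance PathAlgebra.instAlgebra (W : Type u) [Fintype W] [Quiver.{v} W] :
    Algebra ℂ (PathAlgebra W) := inferInstanceAs (Algebra ℂ (RingQuot (PathRel W)))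

/-- The arrow `a`, as an element of the path algebra. -/
def PathAlgebra.arrow {W : Type u} [Fintype W] [Quiver.{v} W] {i j : W} (a : i ⟶ j) :
    PathAlgebra W :=
  RingQuot.mkAlgHom ℂ (PathRel W) (FreeAlgebra.ι ℂ (PathGen.arrow a))

/-- `Quiver.Symmetrify V` is the double quiver: it has the arrows `a` of `V` together with
an opposite arrow `a^* = Quiver.reverse a` for each of them. -/
instance Quiver.Symmetrify.instFintype (V : Type u) [Fintype V] :
    Fintype (Quiver.Symmetrify V) := inferInstanceAs (Fintype V)

/-- The element `∑ a, (a a^* - a^* a)` of the path algebra of the double quiver. -/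
def preprojectiveElement (V : Type u) [Fintype V] [Quiver.{v} V]
    [∀ i j : V, Fintype (i ⟶ j)] : PathAlgebra (Quiver.Symmetrify V) :=
  ∑ i : V, ∑ j : V, ∑ a : i ⟶ j,
    (PathAlgebra.arrow (Quiver.Symmetrify.of.map a) *
        PathAlgebra.arrow (Quiver.reverse (Quiver.Symmetrify.of.map a)) -
      PathAlgebra.arrow (Quiver.reverse (Quiver.Symmetrify.of.map a)) *
        PathAlgebra.arrow (Quiver.Symmetrify.of.map a))

/-- The relation that kills `∑ a, (a a^* - a^* a)`. -/
def preprojectiveRel (V : Type u) [Fintype V] [Quiver.{v} V] [∀ i j : V, Fintype (i ⟶ j)]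
    (x y : PathAlgebra (Quiver.Symmetrify V)) : Prop :=
  x = preprojectiveElement V ∧ y = 0

/-- The preprojective algebra: the path algebra of the double quiver modulo the two-sided ideal
generated by `∑ a, (a a^* - a^* a)`. -/
def PreprojectiveAlgebra (V : Type u) [Fintype V] [Quiver.{v} V]
    [∀ i j : V, Fintype (i ⟶ j)] : Type (max u v) :=
  RingQuot (preprojectiveRel V)

instance PreprojectiveAlgebra.instRing (V : Type u) [Fintype V] [Quiver.{v} V]
    [∀ i j : V, Fintype (i ⟶ j)] : Ring (PreprojectiveAlgebra V) :=
  inferInstanceAs (Ring (RingQuot (preprojectiveRel V)))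

instance PreprojectiveAlgebra.instAlgebra (V : Type u) [Fintype V] [Quiver.{v} V]
    [∀ i j : V, Fintype (i ⟶ j)] : Algebra ℂ (PreprojectiveAlgebra V) :=
  inferInstanceAs (Algebra ℂ (RingQuot (preprojectiveRel V)))

open scoped Classical in
/-- Value at a generator of the character of the path algebra belonging to the vertex `i`. -/
def vertexCharGen {W : Type u} [Quiver.{v} W] (i : W) : PathGen W → ℂ
  | PathGen.vertex j => if j = i then 1 else 0
  | PathGen.arrow _ => 0

theorem vertexCharGen_rel {W : Type u} [Fintype W] [Quiver.{v} W] (i : W)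
    {x y : FreeAlgebra ℂ (PathGen W)} (h : PathRel W x y) :
    FreeAlgebra.lift ℂ (vertexCharGen i) x = FreeAlgebra.lift ℂ (vertexCharGen i) y := by
  classical
  cases h with
  | idem j => simp [vertexCharGen]
  | orth j k hjk =>
    simp only [map_mul, FreeAlgebra.lift_ι_apply, vertexCharGen, map_zero]
    split_ifs with h1 h2 <;> simp_all
  | one => simp [vertexCharGen]
  | head a => simp [vertexCharGen]
  | tail a => simp [vertexCharGen]

/-- The character of the path algebra with `e_i ↦ 1`, and all other `e_j` and all arrows `↦ 0`. -/
def PathAlgebra.vertexChar {W : Type u} [Fintype W] [Quiver.{v} W] (i : W) :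
    PathAlgebra W →ₐ[ℂ] ℂ :=
  RingQuot.liftAlgHom ℂ ⟨FreeAlgebra.lift ℂ (vertexCharGen i), fun _ _ h => vertexCharGen_rel i h⟩

theorem PathAlgebra.vertexChar_arrow {W : Type u} [Fintype W] [Quiver.{v} W] (i : W)
    {j k : W} (a : j ⟶ k) : PathAlgebra.vertexChar i (PathAlgebra.arrow a) = 0 := by
  unfold PathAlgebra.vertexChar PathAlgebra.arrow
  erw [RingQuot.liftAlgHom_mkAlgHom_apply]
  simp [vertexCharGen]

theorem PathAlgebra.vertexChar_rel {V : Type u} [Fintype V] [Quiver.{v} V]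
    [∀ i j : V, Fintype (i ⟶ j)] (i : V) {x y : PathAlgebra (Quiver.Symmetrify V)}
    (h : preprojectiveRel V x y) :
    PathAlgebra.vertexChar (W := Quiver.Symmetrify V) i x =
      PathAlgebra.vertexChar (W := Quiver.Symmetrify V) i y := by
  obtain ⟨rfl, rfl⟩ := h
  simp only [preprojectiveElement, map_sum, map_sub, map_mul, map_zero]
  exact Finset.sum_eq_zero fun j _ => Finset.sum_eq_zero fun k _ => Finset.sum_eq_zero fun a _ =>
    sub_eq_zero.mpr (mul_comm _ _)

/-- The character of the preprojective algebra belonging to the vertex `i`. -/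
def PreprojectiveAlgebra.vertexChar {V : Type u} [Fintype V] [Quiver.{v} V]
    [∀ i j : V, Fintype (i ⟶ j)] (i : V) : PreprojectiveAlgebra V →ₐ[ℂ] ℂ :=
  RingQuot.liftAlgHom ℂ ⟨PathAlgebra.vertexChar (W := Quiver.Symmetrify V) i,
    fun _ _ h => PathAlgebra.vertexChar_rel i h⟩

/-- The simple module `S_i` of the vertex `i`: one-dimensional, `e_i` acts as the identity, all
other `e_j` and all arrows act as zero. -/
def vertexSimple (V : Type u) [Fintype V] [Quiver.{v} V] [∀ i j : V, Fintype (i ⟶ j)] (i : V) :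
    ModuleCat.{0} (PreprojectiveAlgebra V) :=
  (ModuleCat.restrictScalars (PreprojectiveAlgebra.vertexChar i).toRingHom).obj (ModuleCat.of ℂ ℂ)

/-- Nilpotent finite-dimensional left modules: those with a composition series all of whose factors
are among the simple modules `S_i` (such a module is finite-dimensional automatically). -/
def isNilpotentModule (V : Type u) [Fintype V] [Quiver.{v} V] [∀ i j : V, Fintype (i ⟶ j)] :
    ObjectProperty (ModuleCat.{w} (PreprojectiveAlgebra V)) := fun M =>
  ∃ (l : ℕ) (F : Fin (l + 1) → Submodule (PreprojectiveAlgebra V) M),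
    F 0 = ⊥ ∧ F (Fin.last l) = ⊤ ∧ ∀ k : Fin l, F k.castSucc ≤ F k.succ ∧
      ∃ i : V, Nonempty
        ((↥(F k.succ) ⧸ (F k.castSucc).submoduleOf (F k.succ)) ≃ₗ[PreprojectiveAlgebra V]
          vertexSimple V i)

/-- The category of nilpotent finite-dimensional modules over the preprojective algebra. -/
abbrev PreprojectiveNil (V : Type u) [Fintype V] [Quiver.{v} V]
    [∀ i j : V, Fintype (i ⟶ j)] : Type (max u v (w + 1)) :=
  (isNilpotentModule.{u, v, w} V).FullSubcategory

end Algebras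

/-! ### Central charges and stability -/

section Stability

/-- The Grothendieck group: free abelian group on the objects modulo
`[X₂] = [X₁] + [X₃]` for every short exact sequence `0 ⟶ X₁ ⟶ X₂ ⟶ X₃ ⟶ 0`. -/
abbrev GrothendieckK (A : Type u) [Category.{v} A] [HasZeroMorphisms A] : Type u :=
  FreeAbelianGroup A ⧸ AddSubgroup.closure
    {x : FreeAbelianGroup A | ∃ S : ShortComplex A, S.ShortExact ∧
      x = FreeAbelianGroup.of S.X₂ - FreeAbelianGroup.of S.X₁ - FreeAbelianGroup.of S.X₃}

/-- The class of an object in the Grothendieck group. -/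
def GrothendieckK.cls {A : Type u} [Category.{v} A] [HasZeroMorphisms A] (X : A) :
    GrothendieckK A :=
  QuotientAddGroup.mk (FreeAbelianGroup.of X)

/-- The half-plane `{r exp(iπφ) | r > 0, 0 < φ ≤ 1}`. -/
def closedUpperHalfPlane : Set ℂ :=
  {z | ∃ r φ : ℝ, 0 < r ∧ 0 < φ ∧ φ ≤ 1 ∧ z = r * Complex.exp (Complex.I * Real.pi * φ)}

/-- A central charge on an abelian category. -/
structure CentralCharge (A : Type u) [Category.{v} A] [HasZeroMorphisms A] where
  /-- the underlying homomorphism -/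
  hom : GrothendieckK A →+ ℂ
  hom_mem : ∀ X : A, ¬ IsZero X → hom (GrothendieckK.cls X) ∈ closedUpperHalfPlane

namespace CentralCharge

variable {A : Type u} [Category.{v} A] [HasZeroMorphisms A] (Z : CentralCharge A)

/-- The phase of a nonzero object: the `φ ∈ (0, 1]` with `Z(X) = r exp(iπφ)`, `r > 0`. -/
def phase (X : A) : ℝ := Complex.arg (Z.hom (GrothendieckK.cls X)) / Real.pi

/-- A nonzero object is stable if every nonzero proper subobject has strictly smaller phase. -/
def IsStable (X : A) : Prop :=
  ¬ IsZero X ∧ ∀ Y : Subobject X, ¬ IsZero (Y : A) → Y ≠ ⊤ → Z.phase (Y : A) < Z.phase X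

/-- Different (i.e. non-isomorphic) stable objects have different phases. -/
def IsDiscrete : Prop :=
  ∀ X Y : A, Z.IsStable X → Z.IsStable Y → Z.phase X = Z.phase Y → Nonempty (X ≅ Y)

/-- There are finitely many stable objects up to isomorphism. -/
def HasFinitelyManyStables : Prop :=
  ∃ (m : ℕ) (E : Fin m → A), ∀ X : A, Z.IsStable X → ∃ k, Nonempty (X ≅ E k)

/-- `E` lists the stable objects (up to isomorphism) in order of decreasing phase. As the phases
decrease strictly, each isomorphism class occurs exactly once. -/
structure IsStableListing {m : ℕ} (E : Fin m → A) : Prop where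
  isStable : ∀ k, Z.IsStable (E k)
  exhaustive : ∀ X : A, Z.IsStable X → ∃ k, Nonempty (X ≅ E k)
  phase_strictAnti : StrictAnti fun k => Z.phase (E k)

end CentralCharge

end Stability

/-! ### Simple tilts and maximal green sequences -/

section Tilting

variable {D : Type u} [Category.{v} D] [Preadditive D] [HasZeroObject D] [HasShift D ℤ]
  [∀ n : ℤ, (shiftFunctor D n).Additive] [Pretriangulated D]

/-- A bounded t-structure. -/
def IsBoundedTStructure (t : TStructure D) : Prop := ∀ X : D, t.bounded X

/-- `S` is a simple object of the heart of `t`. -/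
def IsSimpleInHeart (t : TStructure D) (S : D) : Prop :=
  ∃ hS : t.heart S, Simple (⟨S, hS⟩ : t.heart.FullSubcategory)

/-- The heart of `t` is algebraic with exactly `n` simple objects up to isomorphism: there are no
infinite chains of subobjects or quotients, and there are `n` simple objects. -/
structure IsAlgebraicHeart (t : TStructure D) (n : ℕ) : Prop where
  artinian : ∀ X : t.heart.FullSubcategory, WellFoundedLT (Subobject X)
  noetherian : ∀ X : t.heart.FullSubcategory, WellFoundedGT (Subobject X)
  simples : ∃ S : Fin n → t.heart.FullSubcategory, (∀ i, Simple (S i)) ∧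
    (∀ i j, Nonempty (S i ≅ S j) → i = j) ∧
    ∀ X : t.heart.FullSubcategory, Simple X → ∃ i, Nonempty (X ≅ S i)

/-- The extension closure `⟨S⟩`, an isomorphism-closed full subcategory. If `S` lies in the heart
of a t-structure, then so does `⟨S⟩`, and the triangles used here are exactly the short exact
sequences of the heart. -/
inductive ExtensionClosure (S : D) : D → Prop
  | zero {X : D} (hX : IsZero X) : ExtensionClosure S X
  | of_iso {X : D} (e : X ≅ S) : ExtensionClosure S X
  | ext {X Y Z : D} (f : X ⟶ Y) (g : Y ⟶ Z) (h : Z ⟶ X⟦(1 : ℤ)⟧)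
      (hT : Triangle.mk f g h ∈ distTriang D) (hX : ExtensionClosure S X)
      (hZ : ExtensionClosure S Z) : ExtensionClosure S Y

/-- The objects `X` of the heart of `t` with `Hom(S, X) = 0`. -/
def heartOrthogonal (t : TStructure D) (S : D) : ObjectProperty D :=
  fun X => t.heart X ∧ ∀ f : S ⟶ X, f = 0

/-- `(T, F)` is a torsion pair in the heart of `t`. (Short exact sequences of the heart
are the distinguished triangles with all three vertices in the heart.) -/
structure IsTorsionPair (t : TStructure D) (T F : ObjectProperty D) : Prop where
  torsion_le : T ≤ t.heart
  torsionFree_le : F ≤ t.heart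
  hom_eq_zero : ∀ (X Y : D), T X → F Y → ∀ f : X ⟶ Y, f = 0
  exists_triangle : ∀ E : D, t.heart E → ∃ (X Y : D) (_ : T X) (_ : F Y)
    (f : X ⟶ E) (g : E ⟶ Y) (h : Y ⟶ X⟦(1 : ℤ)⟧), Triangle.mk f g h ∈ distTriang D

/-- The left tilt with respect to `(T, F)`: the objects `E` with `H^0(E) ∈ F`, `H^1(E) ∈ T` and
no other cohomology with respect to the t-structure in whose heart `(T, F)` is a torsion pair,
that is, the objects `E` in a triangle `Y ⟶ E ⟶ X[-1] ⟶ Y[1]` with `Y ∈ F` and `X ∈ T`. -/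
def leftTilt (T F : ObjectProperty D) : ObjectProperty D := fun E =>
  ∃ (X Y : D) (_ : T X) (_ : F Y) (f : Y ⟶ E) (g : E ⟶ X⟦(-1 : ℤ)⟧)
    (h : X⟦(-1 : ℤ)⟧ ⟶ Y⟦(1 : ℤ)⟧), Triangle.mk f g h ∈ distTriang D

/-- The heart of `t'` is the simple left tilt of the heart of `t` at the simple object `S`. -/
structure IsSimpleTilt (t t' : TStructure D) (S : D) : Prop where
  simple : IsSimpleInHeart t S
  torsionPair : IsTorsionPair t (ExtensionClosure S) (heartOrthogonal t S)
  heart_eq : t'.heart = leftTilt (ExtensionClosure S) (heartOrthogonal t S)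

/-- The hearts of `𝓗 0, …, 𝓗 m` form a green sequence of the heart of `t`, tilting successively at
`E 0, …, E (m - 1)`: it starts at the heart of `t`, all its members are hearts of bounded
t-structures and algebraic with the same number of simple objects, each one is the simple tilt of
the preceding one at `E k`, and all `E k` lie in the heart of `t`. -/
structure IsGreenSequence (t : TStructure D) {m : ℕ} (E : Fin m → D)
    (𝓗 : Fin (m + 1) → TStructure D) : Prop where
  heart_zero : (𝓗 0).heart = t.heart
  bounded : ∀ k, IsBoundedTStructure (𝓗 k)
  algebraic : ∃ n : ℕ, ∀ k, IsAlgebraicHeart (𝓗 k) n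
  simpleTilt : ∀ k : Fin m, IsSimpleTilt (𝓗 k.castSucc) (𝓗 k.succ) (E k)
  green : ∀ k : Fin m, t.heart (E k)

/-- Tilting the heart `𝓐` of `t` successively at the objects `E k` gives a green sequence that ends
in the shifted heart `𝓐[-1] = {X | X[1] ∈ 𝓐}`. -/
def IsMaximalGreenSequence (t : TStructure D) {m : ℕ} (E : Fin m → D) : Prop :=
  ∃ 𝓗 : Fin (m + 1) → TStructure D, IsGreenSequence t E 𝓗 ∧
    ∀ X : D, (𝓗 (Fin.last m)).heart X ↔ t.heart (X⟦(1 : ℤ)⟧)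

end Tilting

end

/-! Since `Z` is discrete, distinct stable objects have distinct phases. Every object of the heart
`𝓐` therefore has a Harder–Narasimhan type filtration whose factors are stable objects `E i` with
weakly increasing index (`IsStableSequence.sortedFiltration`), while Hom(E i, E j) = 0 for i < j. So
for every `k` the extension closures of the first `k` stable objects and of the remaining ones form
a torsion pair in `𝓐`. Instead of iterating simple tilts, `𝓐` is tilted once at each of these pairs.
For k = 0 the torsion class is zero and the heart is `𝓐`; for k = m it is all of `𝓐` and the heart
is `𝓐[-1]`. It remains to study one of these hearts and to compare neighbours.

The `k`-th heart is generated under extensions by the `E j` with k ≤ j and the E j[-1] with j < k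
(`tiltGen`). Shifting negates the charges of the largest phases, so the charges of all generators
lie in one open half-plane (`exists_planeDet_pos`). A linear form on the plane is then at least 1 on
all nonzero objects, which gives finite length. The charge of `E k` spans an extremal ray of the
cone of these charges, and no other generator lies on that ray; hence `E k` is simple
(`isSimpleInHeart_tilt`). The octahedral axiom identifies the next heart with the simple tilt at `E
k` (`isSimpleTilt`).

That the number of simple objects never changes is proved by a count that does not mention the
heart: it is the dimension of the space of rational functions on `D` that are additive on triangles
(`card_simples_eq_finrank`). The values of such a function on the simples of a heart of finite
length are arbitrary, by Jordan–Hölder (`HasSeries.unique`) and by extending from the heart to `D`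
as an Euler characteristic (`EulerChar.isTriangleAdditive_value`). The same extension turns `Z` into
a function on `D`. -/

noncomputable section

/-! ### Distinguished triangles without a named connecting morphism. -/

namespace CategoryTheory.Pretriangulated

section Dist

variable {D : Type u} [Category.{v} D] [Preadditive D] [HasZeroObject D] [HasShift D ℤ]
  [∀ n : ℤ, (shiftFunctor D n).Additive] [Pretriangulated D]

/-- `f` and `g` are the first two morphisms of a distinguished triangle. -/
def Dist {X Y Z : D} (f : X ⟶ Y) (g : Y ⟶ Z) : Prop :=
  ∃ h : Z ⟶ X⟦(1 : ℤ)⟧, Triangle.mk f g h ∈ distTriang D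

namespace Dist

theorem of_mem {T : Triangle D} (hT : T ∈ distTriang D) : Dist T.mor₁ T.mor₂ := ⟨T.mor₃, hT⟩

variable {X Y Z : D} {f : X ⟶ Y} {g : Y ⟶ Z}

theorem comp_eq_zero (h : Dist f g) : f ≫ g = 0 := by
  obtain ⟨h, hT⟩ := h
  exact comp_distTriang_mor_zero₁₂ _ hT

theorem of_iso {X' Y' Z' : D} {f' : X' ⟶ Y'} {g' : Y' ⟶ Z'} (h : Dist f g) (e₁ : X' ≅ X)
    (e₂ : Y' ≅ Y) (e₃ : Z' ≅ Z) (w₁ : f' ≫ e₂.hom = e₁.hom ≫ f)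
    (w₂ : g' ≫ e₃.hom = e₂.hom ≫ g) : Dist f' g' := by
  obtain ⟨h, hT⟩ := h
  -- The third morphism is free to choose, so it is transported along the isomorphisms.
  refine ⟨e₃.hom ≫ h ≫ e₁.inv⟦1⟧', isomorphic_distinguished _ hT _ ?_⟩
  refine Triangle.isoMk _ _ e₁ e₂ e₃ w₁ w₂ ?_
  change (e₃.hom ≫ h ≫ e₁.inv⟦1⟧') ≫ e₁.hom⟦1⟧' = e₃.hom ≫ h
  rw [Category.assoc, Category.assoc, ← Functor.map_comp, Iso.inv_hom_id, Functor.map_id,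
    Category.comp_id]

theorem rotate (h : Dist f g) : ∃ k : Z ⟶ X⟦(1 : ℤ)⟧, Dist g k := by
  obtain ⟨h, hT⟩ := h
  exact ⟨h, _, rot_of_distTriang _ hT⟩

theorem invRotate (h : Dist f g) : ∃ k : Z⟦(-1 : ℤ)⟧ ⟶ X, Dist k f := by
  obtain ⟨h, hT⟩ := h
  exact ⟨_, _, inv_rot_of_distTriang _ hT⟩

theorem shift (h : Dist f g) (n : ℤ) :
    ∃ (a : X⟦n⟧ ⟶ Y⟦n⟧) (b : Y⟦n⟧ ⟶ Z⟦n⟧), Dist a b := by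
  obtain ⟨h, hT⟩ := h
  exact ⟨_, _, _, Triangle.shift_distinguished _ hT n⟩

theorem id_zero (X : D) {Z : D} (hZ : IsZero Z) : Dist (𝟙 X) (0 : X ⟶ Z) :=
  of_iso (of_mem (contractible_distinguished X)) (Iso.refl _) (Iso.refl _)
    (hZ.iso (isZero_zero D)) rfl (zero_comp.trans comp_zero.symm)

theorem of_isIso_left {X Y Z : D} (f : X ⟶ Y) [IsIso f] (hZ : IsZero Z) :
    Dist f (0 : Y ⟶ Z) :=
  of_iso (id_zero Y hZ) (asIso f) (Iso.refl _) (Iso.refl _) (by simp) (by simp)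

theorem zero_id (X : D) {Z : D} (hZ : IsZero Z) : Dist (0 : Z ⟶ X) (𝟙 X) :=
  of_iso (of_mem (contractible_distinguished₁ X)) (hZ.iso (isZero_zero D)) (Iso.refl _)
    (Iso.refl _) (zero_comp.trans comp_zero.symm) rfl

theorem of_isIso_right {X Y Z : D} (g : X ⟶ Y) [IsIso g] (hZ : IsZero Z) :
    Dist (0 : Z ⟶ X) g :=
  of_iso (zero_id Y hZ) (Iso.refl _) (asIso g) (Iso.refl _) (by simp) (by simp)

theorem isZero₂ (h : Dist f g) (hX : IsZero X) (hZ : IsZero Z) : IsZero Y := by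
  obtain ⟨h, hT⟩ := h
  exact Triangle.isZero₂_of_isZero₁₃ _ hT hX hZ

theorem isIso_left (h : Dist f g) (hZ : IsZero Z) : IsIso f := by
  obtain ⟨h, hT⟩ := h
  exact (Triangle.isZero₃_iff_isIso₁ _ hT).1 hZ

theorem isIso_right (h : Dist f g) (hX : IsZero X) : IsIso g := by
  obtain ⟨h, hT⟩ := h
  exact (Triangle.isZero₁_iff_isIso₂ _ hT).1 hX

theorem isZero_right (h : Dist f g) (hf : IsIso f) : IsZero Z := by
  obtain ⟨h, hT⟩ := h
  exact (Triangle.isZero₃_iff_isIso₁ _ hT).2 hf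

theorem isZero_left (h : Dist f g) (hf : IsIso g) : IsZero X := by
  obtain ⟨h, hT⟩ := h
  exact (Triangle.isZero₁_iff_isIso₂ _ hT).2 hf

theorem lift (h : Dist f g) {W : D} (k : W ⟶ Y) (hk : k ≫ g = 0) : ∃ l : W ⟶ X, k = l ≫ f := by
  obtain ⟨h, hT⟩ := h
  exact Triangle.coyoneda_exact₂ _ hT k hk

theorem desc (h : Dist f g) {W : D} (k : Y ⟶ W) (hk : f ≫ k = 0) : ∃ l : Z ⟶ W, k = g ≫ l := by
  obtain ⟨h, hT⟩ := h
  exact Triangle.yoneda_exact₂ _ hT k hk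

theorem desc_shift (h : Dist f g) {W : D} (k : Z ⟶ W) (hk : g ≫ k = 0) :
    ∃ (a : Z ⟶ X⟦(1 : ℤ)⟧) (l : X⟦(1 : ℤ)⟧ ⟶ W), k = a ≫ l := by
  obtain ⟨h, hT⟩ := h
  exact ⟨_, Triangle.yoneda_exact₃ _ hT k hk⟩

theorem lift_shift (h : Dist f g) {W : D} (k : W ⟶ X) (hk : k ≫ f = 0) :
    ∃ (l : W ⟶ Z⟦(-1 : ℤ)⟧) (a : Z⟦(-1 : ℤ)⟧ ⟶ X), k = l ≫ a := by
  obtain ⟨h, hT⟩ := h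
  obtain ⟨l, hl⟩ := Triangle.coyoneda_exact₂ _ (inv_rot_of_distTriang _ hT) k hk
  exact ⟨l, _, hl⟩

theorem isoLeft (h : Dist f g) {X' : D} (e : X' ≅ X) : Dist (e.hom ≫ f) g :=
  h.of_iso e (Iso.refl _) (Iso.refl _) (by simp) (by simp)

theorem isoRight (h : Dist f g) {Z' : D} (e : Z ≅ Z') : Dist f (g ≫ e.hom) :=
  h.of_iso (Iso.refl _) (Iso.refl _) e.symm (by simp) (by simp)

theorem isoMiddle (h : Dist f g) {Y' : D} (e : Y ≅ Y') : Dist (f ≫ e.hom) (e.inv ≫ g) :=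
  h.of_iso (Iso.refl _) e.symm (Iso.refl _) (by simp) (by simp)

/-- A triangle `Z[-1] ⟶ X ⟶ Y` gives a triangle `X ⟶ Y ⟶ Z`. -/
theorem unshift {X Y Z : D} {f : Z⟦(-1 : ℤ)⟧ ⟶ X} {g : X ⟶ Y} (h : Dist f g) :
    ∃ k : Y ⟶ Z, Dist g k := by
  obtain ⟨k, hk⟩ := h.rotate
  exact ⟨_, hk.isoRight ((shiftFunctorCompIsoId D (-1 : ℤ) 1 (by simp)).app Z)⟩

variable [IsTriangulated D]

/-- The octahedron of two composable morphisms, with cones. -/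
theorem octahedron {X₁ X₂ X₃ Z₁₂ Z₂₃ : D} {u₁₂ : X₁ ⟶ X₂} {u₂₃ : X₂ ⟶ X₃} {v₁₂ : X₂ ⟶ Z₁₂}
    {v₂₃ : X₃ ⟶ Z₂₃} (h₁₂ : Dist u₁₂ v₁₂) (h₂₃ : Dist u₂₃ v₂₃) :
    ∃ (Z₁₃ : D) (v₁₃ : X₃ ⟶ Z₁₃) (m₁ : Z₁₂ ⟶ Z₁₃) (m₃ : Z₁₃ ⟶ Z₂₃),
      Dist (u₁₂ ≫ u₂₃) v₁₃ ∧ Dist m₁ m₃ ∧ v₁₂ ≫ m₁ = u₂₃ ≫ v₁₃ ∧ v₁₃ ≫ m₃ = v₂₃ := by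
  obtain ⟨w₁₂, h₁₂⟩ := h₁₂
  obtain ⟨w₂₃, h₂₃⟩ := h₂₃
  obtain ⟨Z₁₃, v₁₃, w₁₃, h₁₃⟩ := distinguished_cocone_triangle (u₁₂ ≫ u₂₃)
  let H := someOctahedron rfl h₁₂ h₂₃ h₁₃
  exact ⟨Z₁₃, v₁₃, H.m₁, H.m₃, ⟨_, h₁₃⟩, ⟨_, H.mem⟩, H.comm₁, H.comm₃⟩

/-- The octahedron of two composable morphisms, with fibres. -/
theorem octahedron' {X₁ X₂ X₃ Z₁₂ Z₂₃ : D} {u₁₂ : X₁ ⟶ X₂} {u₂₃ : X₂ ⟶ X₃} {v₁₂ : Z₁₂ ⟶ X₁}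
    {v₂₃ : Z₂₃ ⟶ X₂} (h₁₂ : Dist v₁₂ u₁₂) (h₂₃ : Dist v₂₃ u₂₃) :
    ∃ (Z₁₃ : D) (v₁₃ : Z₁₃ ⟶ X₁) (m₁ : Z₁₂ ⟶ Z₁₃) (m₃ : Z₁₃ ⟶ Z₂₃),
      Dist v₁₃ (u₁₂ ≫ u₂₃) ∧ Dist m₁ m₃ ∧ m₁ ≫ v₁₃ = v₁₂ ∧ m₃ ≫ v₂₃ = v₁₃ ≫ u₁₂ := by
  obtain ⟨w₁₂, h₁₂⟩ := h₁₂
  obtain ⟨w₂₃, h₂₃⟩ := h₂₃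
  obtain ⟨Z₁₃, v₁₃, w₁₃, h₁₃⟩ := distinguished_cocone_triangle₁ (u₁₂ ≫ u₂₃)
  let H := someOctahedron' rfl h₁₂ h₂₃ h₁₃
  exact ⟨Z₁₃, v₁₃, H.m₁, H.m₃, ⟨_, h₁₃⟩, ⟨_, H.mem⟩, H.comm₁, H.comm₄⟩

end Dist

end Dist

end CategoryTheory.Pretriangulated

/-! ### Hearts of t-structures as abelian categories. -/

namespace CategoryTheory.Triangulated.TStructure

section Heart

variable {D : Type u} [Category.{v} D] [Preadditive D] [HasZeroObject D] [HasShift D ℤ]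
  [∀ n : ℤ, (shiftFunctor D n).Additive] [Pretriangulated D] (t : TStructure D)

theorem isLE_of_dist {X Y Z : D} {f : X ⟶ Y} {g : Y ⟶ Z} (h : Dist f g) (n : ℤ)
    (hX : t.IsLE X n) (hZ : t.IsLE Z n) : t.IsLE Y n := by
  obtain ⟨h, hT⟩ := h
  exact t.isLE₂ _ hT n hX hZ

theorem isGE_of_dist {X Y Z : D} {f : X ⟶ Y} {g : Y ⟶ Z} (h : Dist f g) (n : ℤ)
    (hX : t.IsGE X n) (hZ : t.IsGE Z n) : t.IsGE Y n := by
  obtain ⟨h, hT⟩ := h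
  exact t.isGE₂ _ hT n hX hZ

theorem isLE_cone {X Y Z : D} {f : X ⟶ Y} {g : Y ⟶ Z} (h : Dist f g) (n : ℤ)
    (hX : t.IsLE X (n + 1)) (hY : t.IsLE Y n) : t.IsLE Z n := by
  obtain ⟨k, hk⟩ := h.rotate
  exact t.isLE_of_dist hk n hY (t.isLE_shift X (n + 1) 1 n)

theorem isGE_fibre {X Y Z : D} {f : X ⟶ Y} {g : Y ⟶ Z} (h : Dist f g) (n : ℤ)
    (hY : t.IsGE Y n) (hZ : t.IsGE Z (n - 1)) : t.IsGE X n := by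
  obtain ⟨k, hk⟩ := h.invRotate
  exact t.isGE_of_dist hk n (t.isGE_shift Z (n - 1) (-1) n) hY

theorem exists_dist (X : D) (n₀ n₁ : ℤ) (h : n₀ + 1 = n₁) :
    ∃ (A B : D) (f : A ⟶ X) (g : X ⟶ B), t.IsLE A n₀ ∧ t.IsGE B n₁ ∧ Dist f g := by
  obtain ⟨A, B, hA, hB, f, g, k, hT⟩ := t.exists_triangle X n₀ n₁ h
  exact ⟨A, B, f, g, ⟨hA⟩, ⟨hB⟩, k, hT⟩

theorem heart_of_dist {X Y Z : D} {f : X ⟶ Y} {g : Y ⟶ Z} (h : Dist f g)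
    (hX : t.heart X) (hZ : t.heart Z) : t.heart Y := by
  rw [mem_heart_iff] at *
  exact ⟨t.isLE_of_dist h 0 hX.1 hZ.1, t.isGE_of_dist h 0 hX.2 hZ.2⟩

theorem heart_of_isZero {X : D} (hX : IsZero X) : t.heart X :=
  (t.mem_heart_iff X).2 ⟨t.isLE_of_isZero hX 0, t.isGE_of_isZero hX 0⟩

variable {t}

theorem hom_eq_zero_of_heart {X Y : D} (hX : t.heart X) (hY : t.heart Y) {n : ℤ} (hn : n < 0)
    (f : X ⟶ Y⟦n⟧) : f = 0 := by
  rw [mem_heart_iff] at hX hY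
  have := hX.1
  have := hY.2
  have := t.isGE_shift Y 0 n (-n)
  exact t.zero f 0 (-n)

theorem hom_shift_eq_zero_of_heart {X Y : D} (hX : t.heart X) (hY : t.heart Y)
    (f : X⟦(1 : ℤ)⟧ ⟶ Y) : f = 0 := by
  rw [mem_heart_iff] at hX hY
  have := hX.1
  have := hY.2
  have := t.isLE_shift X 0 1 (-1)
  exact t.zero f (-1) 0

/-- The first morphism of a triangle in the heart is a monomorphism in the heart. -/
theorem eq_zero_of_comp_left {X Y Z W : D} {f : X ⟶ Y} {g : Y ⟶ Z} (h : Dist f g)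
    (hZ : t.heart Z) (hW : t.heart W) {k : W ⟶ X} (hk : k ≫ f = 0) : k = 0 := by
  obtain ⟨l, a, rfl⟩ := h.lift_shift k hk
  rw [hom_eq_zero_of_heart hW hZ (by simp) l, zero_comp]

/-- The second morphism of a triangle in the heart is an epimorphism in the heart. -/
theorem eq_zero_of_comp_right {X Y Z W : D} {f : X ⟶ Y} {g : Y ⟶ Z} (h : Dist f g)
    (hX : t.heart X) (hW : t.heart W) {k : Z ⟶ W} (hk : g ≫ k = 0) : k = 0 := by
  obtain ⟨a, l, rfl⟩ := h.desc_shift k hk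
  rw [hom_shift_eq_zero_of_heart hX hW l, comp_zero]

instance : t.heart.ContainsZero where
  exists_zero := ⟨_, isZero_zero D, t.heart_of_isZero (isZero_zero D)⟩

/-- A product is an extension of its factors, and the heart is closed under extensions. -/
instance : t.heart.IsClosedUnderBinaryProducts where
  limitsOfShape_le := by
    rintro X ⟨p⟩
    refine t.heart.prop_of_iso ?_ (t.heart_of_dist
      (Dist.of_mem (binaryProductTriangle_distinguished _ _))
      (p.prop_diag_obj (.mk .left)) (p.prop_diag_obj (.mk .right)))
    exact IsLimit.conePointUniqueUpToIso (prodIsProd _ _)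
      ((IsLimit.postcomposeHomEquiv (diagramIsoPair p.diag) _).2 p.isLimit)

instance : t.heart.IsClosedUnderFiniteProducts := .mk'

variable (t)
variable {A : Type u'} [Category.{v'} A] [Preadditive A] [t.Heart A]

variable (A) in
theorem exists_iso_ιHeart {X : D} (hX : t.heart X) : ∃ a : A, Nonempty (t.ιHeart.obj a ≅ X) := by
  rw [← t.essImage_ιHeart A] at hX
  exact hX

theorem ιHeart_hom_eq_zero ⦃X Y : A⦄ ⦃n : ℤ⦄ (f : t.ιHeart.obj X ⟶ (t.ιHeart.obj Y)⟦n⟧)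
    (hn : n < 0) : f = 0 :=
  hom_eq_zero_of_heart (t.ιHeart_obj_mem X) (t.ιHeart_obj_mem Y) hn f

-- The cone of a morphism of the heart lives in degrees -1 and 0. Its truncation triangle has the
-- kernel, shifted by one, on the left and the cokernel on the right.
variable (A) in
theorem ιHeart_admissible :
    AbelianSubcategory.admissibleMorphism (t.ιHeart : A ⥤ D) = ⊤ := by
  ext X₁ X₂ f
  simp only [MorphismProperty.top_apply, iff_true]
  intro X₃ f₂ f₃ hT
  have h : Dist (t.ιHeart.map f) f₂ := ⟨_, hT⟩
  have hLE : t.IsLE X₃ 0 := t.isLE_cone h 0 (t.isLE_of_le _ 0 1) inferInstance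
  have hGE : t.IsGE X₃ (-1) := by
    obtain ⟨k, hk⟩ := h.rotate
    exact t.isGE_of_dist hk (-1) (t.isGE_of_ge _ (-1) 0) (t.isGE_shift _ 0 1 (-1))
  obtain ⟨P, Q, a, b, hP, hQ, hab⟩ := t.exists_dist X₃ (-1) 0 (by simp)
  have hQ' : t.heart Q := (t.mem_heart_iff Q).2
    ⟨t.isLE_cone hab 0 (t.isLE_of_le P (-1) (0 + 1)) hLE, hQ⟩
  have hP' : t.heart (P⟦(-1 : ℤ)⟧) := (t.mem_heart_iff _).2
    ⟨t.isLE_shift P (-1) (-1) 0, by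
      have := t.isGE_fibre hab (-1) hGE (t.isGE_of_ge Q (-1 - 1) 0)
      exact t.isGE_shift P (-1) (-1) 0⟩
  obtain ⟨K, ⟨eK⟩⟩ := t.exists_iso_ιHeart A hP'
  obtain ⟨Q', ⟨eQ⟩⟩ := t.exists_iso_ιHeart A hQ'
  obtain ⟨γ, hγ⟩ := (hab.isoRight eQ.symm).isoLeft
    ((shiftFunctor D (1 : ℤ)).mapIso eK ≪≫ (shiftFunctorCompIsoId D (-1 : ℤ) 1 (by simp)).app P)
  exact ⟨K, Q', _, _, γ, hγ⟩

include t in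
variable (A) in
theorem hasFiniteProducts_heart : HasFiniteProducts A := by
  let F : A ⥤ t.heart.FullSubcategory := t.heart.lift t.ιHeart (fun X => t.ιHeart_obj_mem X)
  have : F.Faithful := inferInstance
  have : F.Full := inferInstance
  have : F.EssSurj := ⟨fun X => by
    obtain ⟨a, ⟨e⟩⟩ := t.exists_iso_ιHeart A X.2
    exact ⟨a, ⟨t.heart.isoMk e⟩⟩⟩
  have : F.IsEquivalence := {}
  exact ⟨fun n => Adjunction.hasLimitsOfShape_of_equivalence F⟩

theorem exists_dist_of_epi {X Y : A} (p : X ⟶ Y) [Epi p] :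
    ∃ (K : D) (i : K ⟶ t.ιHeart.obj X), t.heart K ∧ Dist i (t.ιHeart.map p) := by
  obtain ⟨K, i, δ, h⟩ := AbelianSubcategory.exists_distinguished_triangle_of_epi
    t.ιHeart_hom_eq_zero (t.ιHeart_admissible A) p
  exact ⟨_, _, t.ιHeart_obj_mem K, δ, h⟩

/-- In the truncation triangle of the cone, the shifted kernel of a monomorphism vanishes, so the
cone is the cokernel and lies in the heart. -/
theorem exists_dist_of_mono {X Y : A} (i : X ⟶ Y) [Mono i] :
    ∃ (Q : D) (p : t.ιHeart.obj Y ⟶ Q), t.heart Q ∧ Dist (t.ιHeart.map i) p := by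
  obtain ⟨C, f₂, f₃, hT⟩ := distinguished_cocone_triangle (t.ιHeart.map i)
  have hi : AbelianSubcategory.admissibleMorphism t.ιHeart i := by
    rw [t.ιHeart_admissible A]; trivial
  obtain ⟨K, Q, α, β, γ, hT'⟩ := hi f₂ f₃ hT
  have hK : AbelianSubcategory.ιK f₃ α = 0 := by
    rw [← cancel_mono i, AbelianSubcategory.ιK_mor₁ hT α, zero_comp]
  have := AbelianSubcategory.mono_ιK t.ιHeart_hom_eq_zero hT hT'
  have hK' : IsZero ((t.ιHeart.obj K)⟦(1 : ℤ)⟧) := by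
    rw [IsZero.iff_id_eq_zero, ← Functor.map_id, ← Functor.map_id,
      show 𝟙 K = 0 by rw [← cancel_mono (AbelianSubcategory.ιK f₃ α), hK, comp_zero, comp_zero],
      Functor.map_zero, Functor.map_zero]
  have hβ : IsIso β := Dist.isIso_right ⟨γ, hT'⟩ hK'
  exact ⟨C, f₂, t.heart.prop_of_iso (asIso β).symm (t.ιHeart_obj_mem Q), f₃, hT⟩

variable [IsTriangulated D]

variable (A) in
/-- The heart of a t-structure is abelian. -/
@[reducible]
def heartAbelian : Abelian A :=
  have := t.hasFiniteProducts_heart A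
  AbelianSubcategory.abelian t.ιHeart t.ιHeart_hom_eq_zero (t.ιHeart_admissible A)

variable {t} in
/-- Images in the heart. -/
theorem exists_image {X Y : D} (hX : t.heart X) (hY : t.heart Y) (f : X ⟶ Y) :
    ∃ (N I C : D) (a : N ⟶ X) (p : X ⟶ I) (i : I ⟶ Y) (q : Y ⟶ C),
      t.heart N ∧ t.heart I ∧ t.heart C ∧ Dist a p ∧ Dist i q ∧ p ≫ i = f := by
  let := t.hasHeartFullSubcategory
  let := t.heartAbelian t.heart.FullSubcategory
  let X' : t.heart.FullSubcategory := ⟨X, hX⟩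
  let Y' : t.heart.FullSubcategory := ⟨Y, hY⟩
  let f' : X' ⟶ Y' := t.heart.homMk f
  obtain ⟨N, a, hN, h₁⟩ := t.exists_dist_of_epi (Limits.factorThruImage f')
  obtain ⟨C, q, hC, h₂⟩ := t.exists_dist_of_mono (Limits.image.ι f')
  refine ⟨N, _, C, a, _, _, q, hN, t.ιHeart_obj_mem _, hC, h₁, h₂, ?_⟩
  exact (t.ιHeart.map_comp _ _).symm.trans (congrArg t.ιHeart.map (Limits.image.fac f'))

end Heart

end CategoryTheory.Triangulated.TStructure

/-! ### Tilting a t-structure at a torsion pair. -/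

section Tilt

variable {D : Type u} [Category.{v} D] [Preadditive D] [HasZeroObject D] [HasShift D ℤ]
  [∀ n : ℤ, (shiftFunctor D n).Additive] [Pretriangulated D]
  {t : TStructure D} {T F : ObjectProperty D}

theorem mem_leftTilt {X Y E : D} (hX : T X) (hY : F Y) {f : Y ⟶ E} {g : E ⟶ X⟦(-1 : ℤ)⟧}
    (h : Dist f g) : leftTilt T F E := by
  obtain ⟨k, hk⟩ := h
  exact ⟨X, Y, hX, hY, f, g, k, hk⟩

theorem exists_dist_of_leftTilt {E : D} (h : leftTilt T F E) :
    ∃ (X Y : D) (f : Y ⟶ E) (g : E ⟶ X⟦(-1 : ℤ)⟧), T X ∧ F Y ∧ Dist f g := by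
  obtain ⟨X, Y, hX, hY, f, g, k, hk⟩ := h
  exact ⟨X, Y, f, g, hX, hY, k, hk⟩

namespace IsTorsionPair

theorem exists_dist (hTF : IsTorsionPair t T F) {E : D} (hE : t.heart E) :
    ∃ (X Y : D) (f : X ⟶ E) (g : E ⟶ Y), T X ∧ F Y ∧ Dist f g := by
  obtain ⟨X, Y, hX, hY, f, g, k, hk⟩ := hTF.exists_triangle E hE
  exact ⟨X, Y, f, g, hX, hY, k, hk⟩

theorem torsion_of_hom_eq_zero [T.IsClosedUnderIsomorphisms] (hTF : IsTorsionPair t T F) {E : D}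
    (hE : t.heart E) (h : ∀ Y, F Y → ∀ f : E ⟶ Y, f = 0) : T E := by
  obtain ⟨X, Y, f, g, hX, hY, hd⟩ := hTF.exists_dist hE
  have hg := h Y hY g
  have hY' : IsZero Y := by
    rw [IsZero.iff_id_eq_zero]
    exact TStructure.eq_zero_of_comp_right hd (hTF.torsion_le _ hX) (hTF.torsionFree_le _ hY)
      (by rw [hg, zero_comp])
  have := hd.isIso_left hY'
  exact T.prop_of_iso (asIso f) hX

theorem torsionFree_of_hom_eq_zero [F.IsClosedUnderIsomorphisms] (hTF : IsTorsionPair t T F)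
    {E : D} (hE : t.heart E) (h : ∀ X, T X → ∀ f : X ⟶ E, f = 0) : F E := by
  obtain ⟨X, Y, f, g, hX, hY, hd⟩ := hTF.exists_dist hE
  have hf := h X hX f
  have hX' : IsZero X := by
    rw [IsZero.iff_id_eq_zero]
    exact TStructure.eq_zero_of_comp_left hd (hTF.torsionFree_le _ hY) (hTF.torsion_le _ hX)
      (by rw [hf, comp_zero])
  have := hd.isIso_right hX'
  exact F.prop_of_iso (asIso g).symm hY

/-- The aisle of the right tilt: `H^i = 0` for `i > 0`, and `H^0` is torsion. -/
def aisle (_ : IsTorsionPair t T F) : ObjectProperty D := fun X =>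
  t.IsLE X 0 ∧ ∀ Y, F Y → ∀ f : X ⟶ Y, f = 0

/-- The coaisle of the right tilt: `H^i = 0` for `i < 0`, and `H^0` is torsion-free. -/
def coaisle (_ : IsTorsionPair t T F) : ObjectProperty D := fun Y =>
  t.IsGE Y 0 ∧ ∀ X, T X → ∀ f : X ⟶ Y, f = 0

variable (hTF : IsTorsionPair t T F)

instance : hTF.aisle.IsClosedUnderIsomorphisms where
  of_iso {X X'} e h := by
    have := h.1
    refine ⟨t.isLE_of_iso e 0, fun Y hY f => ?_⟩
    rw [← cancel_epi e.hom, comp_zero]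
    exact h.2 Y hY _

instance : hTF.coaisle.IsClosedUnderIsomorphisms where
  of_iso {X X'} e h := by
    have := h.1
    refine ⟨t.isGE_of_iso e 0, fun Y hY f => ?_⟩
    rw [← cancel_mono e.inv, zero_comp]
    exact h.2 Y hY _

theorem isGE_of_torsionFree (hTF : IsTorsionPair t T F) {Y : D} (hY : F Y) : t.IsGE Y 0 :=
  ((t.mem_heart_iff Y).1 (hTF.torsionFree_le Y hY)).2

theorem isLE_of_torsion (hTF : IsTorsionPair t T F) {X : D} (hX : T X) : t.IsLE X 0 :=
  ((t.mem_heart_iff X).1 (hTF.torsion_le X hX)).1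

theorem aisle_of_isLE {X : D} (hX : t.IsLE X (-1)) : hTF.aisle X :=
  ⟨t.isLE_of_le X (-1) 0, fun Y hY f => by
    have := hTF.isGE_of_torsionFree hY
    exact t.zero f (-1) 0⟩

theorem coaisle_of_isGE {Y : D} (hY : t.IsGE Y 1) : hTF.coaisle Y :=
  ⟨t.isGE_of_ge Y 0 1, fun X hX f => by
    have := hTF.isLE_of_torsion hX
    exact t.zero f 0 1⟩

theorem aisle_of_torsion {X : D} (hX : T X) : hTF.aisle X :=
  ⟨hTF.isLE_of_torsion hX, fun Y hY f => hTF.hom_eq_zero X Y hX hY f⟩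

theorem coaisle_of_torsionFree {Y : D} (hY : F Y) : hTF.coaisle Y :=
  ⟨hTF.isGE_of_torsionFree hY, fun X hX f => hTF.hom_eq_zero X Y hX hY f⟩

theorem aisle_of_dist {X Y Z : D} {f : X ⟶ Y} {g : Y ⟶ Z} (h : Dist f g) (hX : hTF.aisle X)
    (hZ : hTF.aisle Z) : hTF.aisle Y := by
  refine ⟨t.isLE_of_dist h 0 hX.1 hZ.1, fun W hW k => ?_⟩
  obtain ⟨l, rfl⟩ := h.desc k (hX.2 W hW _)
  rw [hZ.2 W hW l, comp_zero]

theorem coaisle_of_dist {X Y Z : D} {f : X ⟶ Y} {g : Y ⟶ Z} (h : Dist f g)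
    (hX : hTF.coaisle X) (hZ : hTF.coaisle Z) : hTF.coaisle Y := by
  refine ⟨t.isGE_of_dist h 0 hX.1 hZ.1, fun W hW k => ?_⟩
  obtain ⟨l, rfl⟩ := h.lift k (hZ.2 W hW _)
  rw [hX.2 W hW l, zero_comp]

/-- The zeroth cohomology `H` is cut at the torsion pair. Two octahedra glue its torsion part to the
negative degrees and its torsion-free part to the positive ones. -/
theorem exists_dist_aisle_coaisle [IsTriangulated D] (B : D) :
    ∃ (X Y : D) (f : X ⟶ B) (g : B ⟶ Y), hTF.aisle X ∧ hTF.coaisle Y ∧ Dist f g := by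
  obtain ⟨P, Q, p, q, hP, hQ, hpq⟩ := t.exists_dist B 0 1 (by simp)
  obtain ⟨N, H, n, h, hN, hH, hnh⟩ := t.exists_dist P (-1) 0 (by simp)
  obtain ⟨X, Y, f, g, hX, hY, hfg⟩ := hTF.exists_dist ((t.mem_heart_iff H).2
      ⟨t.isLE_cone hnh 0 (t.isLE_of_le N (-1) (0 + 1)) hP, hH⟩)
  obtain ⟨X', x, m₁, m₃, h₁, h₂, -, -⟩ := hnh.octahedron' hfg
  obtain ⟨Y', y, k₁, k₃, h₃, h₄, -, -⟩ := h₁.octahedron hpq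
  exact ⟨X', Y', x ≫ p, y, hTF.aisle_of_dist h₂ (hTF.aisle_of_isLE hN) (hTF.aisle_of_torsion hX),
    hTF.coaisle_of_dist h₄ (hTF.coaisle_of_torsionFree hY) (hTF.coaisle_of_isGE hQ), h₃⟩

theorem aisle_shift {X : D} (hX : hTF.aisle X) : hTF.aisle (X⟦(1 : ℤ)⟧) :=
  hTF.aisle_of_isLE (by
    have := hX.1
    exact t.isLE_shift X 0 1 (-1))

theorem coaisle_shift {X : D} (hX : hTF.coaisle (X⟦(1 : ℤ)⟧)) : hTF.coaisle X :=
  hTF.coaisle_of_isGE (by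
    have := hX.1
    exact t.isGE_of_shift X 1 1 0)

variable [T.IsClosedUnderIsomorphisms]

/-- A map to the coaisle kills the part of `X` in negative degrees, hence factors through the zeroth
cohomology `B`. That is torsion, because maps from `X` to torsion-free objects vanish and maps from
A[1] do so for degree reasons. -/
theorem hom_aisle_coaisle {X Y : D} (hX : hTF.aisle X) (hY : hTF.coaisle Y) (f : X ⟶ Y) :
    f = 0 := by
  obtain ⟨A, B, a, b, hA, hB, hab⟩ := t.exists_dist X (-1) 0 (by simp)
  have := hX.1
  have := hY.1
  have hBT : T B := by
    refine hTF.torsion_of_hom_eq_zero ((t.mem_heart_iff B).2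
      ⟨t.isLE_cone hab 0 (t.isLE_of_le A (-1) (0 + 1)) hX.1, hB⟩) fun Z hZ k => ?_
    obtain ⟨c, l, rfl⟩ := hab.desc_shift k (hX.2 Z hZ _)
    have := t.isLE_shift A (-1) 1 (-2)
    have := hTF.isGE_of_torsionFree hZ
    rw [t.zero l (-2) 0, comp_zero]
  obtain ⟨l, rfl⟩ := hab.desc f (t.zero _ (-1) 0)
  rw [hY.2 B hBT l, comp_zero]

/-- The left tilt of a t-structure at a torsion pair of its heart. -/
def tilt [IsTriangulated D] : TStructure D where
  -- The shift by one makes the heart the intersection of the coaisle with the aisle shifted by -1,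
  -- so torsion objects sit in degree 1.
  le n X := hTF.aisle (X⟦n + 1⟧)
  ge n X := hTF.coaisle (X⟦n⟧)
  le_isClosedUnderIsomorphisms n :=
    ⟨fun e h => hTF.aisle.prop_of_iso ((shiftFunctor D (n + 1)).mapIso e) h⟩
  ge_isClosedUnderIsomorphisms n :=
    ⟨fun e h => hTF.coaisle.prop_of_iso ((shiftFunctor D n).mapIso e) h⟩
  le_shift n a n' h X hX :=
    hTF.aisle.prop_of_iso ((shiftFunctorAdd' D a (n' + 1) (n + 1) (by omega)).app X) hX
  ge_shift n a n' h X hX :=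
    hTF.coaisle.prop_of_iso ((shiftFunctorAdd' D a n' n (by omega)).app X) hX
  zero' X Y f hX hY := (shiftFunctor D (1 : ℤ)).map_injective (by
    rw [Functor.map_zero]
    exact hTF.hom_aisle_coaisle (hTF.aisle.prop_of_iso
      (eqToIso (by rw [zero_add])) hX) hY _)
  le_zero_le X hX :=
    hTF.aisle.prop_of_iso ((shiftFunctorAdd' D (0 + 1 : ℤ) 1 (1 + 1) (by simp)).symm.app X)
      (hTF.aisle_shift hX)
  ge_one_le X hX := hTF.coaisle.prop_of_iso ((shiftFunctorZero D ℤ).symm.app X)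
    (hTF.coaisle_shift hX)
  exists_triangle_zero_one A := by
    obtain ⟨X, Y, f, g, hX, hY, h⟩ := hTF.exists_dist_aisle_coaisle (A⟦(1 : ℤ)⟧)
    obtain ⟨a, b, h⟩ := h.shift (-1)
    obtain ⟨c, hc⟩ := h.isoMiddle ((shiftFunctorCompIsoId D (1 : ℤ) (-1) (by simp)).app A)
    refine ⟨_, _, ?_, ?_, _, _, _, hc⟩
    · exact hTF.aisle.prop_of_iso
        ((shiftFunctorCompIsoId D (-1 : ℤ) (0 + 1) (by simp)).symm.app X) hX
    · exact hTF.coaisle.prop_of_iso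
        ((shiftFunctorCompIsoId D (-1 : ℤ) 1 (by simp)).symm.app Y) hY

theorem tilt_heart_iff [IsTriangulated D] {X : D} :
    hTF.tilt.heart X ↔ hTF.aisle (X⟦(1 : ℤ)⟧) ∧ hTF.coaisle X := by
  change (hTF.aisle (X⟦(0 + 1 : ℤ)⟧) ∧ hTF.coaisle (X⟦(0 : ℤ)⟧)) ↔ _
  rw [hTF.coaisle.prop_iff_of_iso ((shiftFunctorZero D ℤ).app X),
    hTF.aisle.prop_iff_of_iso (eqToIso (by rw [zero_add] : X⟦(0 + 1 : ℤ)⟧ = X⟦(1 : ℤ)⟧))]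
  rfl

/-- An object of the new heart has cohomology in degrees 0 and 1 only. Maps from torsion objects
detect that the degree 0 part is torsion-free, and maps to torsion-free objects that the degree 1
part is torsion; the other terms of the long exact sequences vanish for degree reasons. -/
theorem tilt_heart [IsTriangulated D] [F.IsClosedUnderIsomorphisms] :
    hTF.tilt.heart = leftTilt T F := by
  ext X
  rw [hTF.tilt_heart_iff]
  constructor
  · rintro ⟨h₁, h₂⟩
    have hLE : t.IsLE X 1 := by
      have := h₁.1
      exact t.isLE_of_shift X 1 1 0
    have := h₂.1
    obtain ⟨Y, W, f, g, hY, hW, h⟩ := t.exists_dist X 0 1 (by simp)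
    have hW' : t.IsLE W 1 := t.isLE_cone h 1 (t.isLE_of_le Y 0 (1 + 1)) hLE
    have hY' : t.heart Y := (t.mem_heart_iff Y).2
      ⟨hY, t.isGE_fibre h 0 h₂.1 (t.isGE_of_ge W (0 - 1) 1)⟩
    have hW'' : t.heart (W⟦(1 : ℤ)⟧) := (t.mem_heart_iff _).2
      ⟨t.isLE_shift W 1 1 0, t.isGE_shift W 1 1 0⟩
    have hYF : F Y := by
      refine hTF.torsionFree_of_hom_eq_zero hY' fun Z hZ k => ?_
      obtain ⟨l, a, rfl⟩ := h.lift_shift k (h₂.2 Z hZ _)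
      have := hTF.isLE_of_torsion hZ
      have := t.isGE_shift W 1 (-1) 2
      rw [t.zero l 0 2, zero_comp]
    have hWT : T (W⟦(1 : ℤ)⟧) := by
      refine hTF.torsion_of_hom_eq_zero hW'' fun Z hZ k => ?_
      obtain ⟨a, b, hab⟩ := h.shift 1
      obtain ⟨c, l, rfl⟩ := hab.desc_shift k (h₁.2 Z hZ _)
      have := hTF.isGE_of_torsionFree hZ
      have := t.isLE_shift Y 0 1 (-1)
      have := t.isLE_shift (Y⟦(1 : ℤ)⟧) (-1) 1 (-2)
      rw [t.zero l (-2) 0, comp_zero]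
    exact mem_leftTilt hWT hYF
      (h.isoRight ((shiftFunctorCompIsoId D (1 : ℤ) (-1) (by simp)).symm.app W))
  · intro hX
    obtain ⟨W, Y, f, g, hW, hY, h⟩ := exists_dist_of_leftTilt hX
    have := hTF.isLE_of_torsion hW
    obtain ⟨a, b, hab⟩ := h.shift 1
    refine ⟨hTF.aisle_of_dist hab ?_ ?_, hTF.coaisle_of_dist h (hTF.coaisle_of_torsionFree hY) ?_⟩
    · have := ((t.mem_heart_iff Y).1 (hTF.torsionFree_le Y hY)).1
      exact hTF.aisle_of_isLE (t.isLE_shift Y 0 1 (-1))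
    · exact hTF.aisle.prop_of_iso
        ((shiftFunctorCompIsoId D (-1 : ℤ) 1 (by simp)).symm.app W) (hTF.aisle_of_torsion hW)
    · have := ((t.mem_heart_iff W).1 (hTF.torsion_le W hW)).2
      exact hTF.coaisle_of_isGE (t.isGE_shift W 0 (-1) 1)

theorem tilt_isBounded [IsTriangulated D] (ht : IsBoundedTStructure t) :
    IsBoundedTStructure hTF.tilt := by
  intro X
  obtain ⟨⟨a, ha⟩, ⟨b, hb⟩⟩ := ht X
  exact ⟨⟨a - 1, ⟨hTF.coaisle_of_isGE (t.isGE_shift X a (a - 1) 1)⟩⟩,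
    ⟨b, ⟨hTF.aisle_of_isLE (t.isLE_shift X b (b + 1) (-1))⟩⟩⟩

end IsTorsionPair

end Tilt

/-! ### Extending additive functions from a bounded heart to the triangulated category. -/

section EulerCharacteristic

variable {D : Type u} [Category.{v} D] [Preadditive D] [HasZeroObject D] [HasShift D ℤ]
  [∀ n : ℤ, (shiftFunctor D n).Additive] [Pretriangulated D] {G : Type w} [AddCommGroup G]

/-- A function on the objects of a triangulated category that is additive on distinguished
triangles. -/
def IsTriangleAdditive (F : D → G) : Prop :=
  ∀ ⦃X Y Z : D⦄ ⦃f : X ⟶ Y⦄ ⦃g : Y ⟶ Z⦄, Dist f g → F Y = F X + F Z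

namespace IsTriangleAdditive

variable {F : D → G} (hF : IsTriangleAdditive F)
include hF

theorem map_isZero {X : D} (hX : IsZero X) : F X = 0 := by
  have := hF (Dist.id_zero X hX)
  simpa using this

theorem map_iso {X Y : D} (e : X ≅ Y) : F X = F Y := by
  have := hF (Dist.of_isIso_left e.hom (isZero_zero D))
  rw [this, hF.map_isZero (isZero_zero D), add_zero]

theorem map_shift (X : D) : F (X⟦(1 : ℤ)⟧) = -F X := by
  obtain ⟨k, hk⟩ := (Dist.id_zero X (isZero_zero D)).rotate
  have h := hF hk
  rw [hF.map_isZero (isZero_zero D)] at h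
  exact (neg_eq_of_add_eq_zero_right h.symm).symm

end IsTriangleAdditive

/-- A function on objects that is additive on the short exact sequences of the heart of `t`. -/
def IsHeartAdditive (t : TStructure D) (f : D → G) : Prop :=
  ∀ ⦃X Y Z : D⦄ ⦃a : X ⟶ Y⦄ ⦃b : Y ⟶ Z⦄, t.heart X → t.heart Z → Dist a b → f Y = f X + f Z

namespace IsHeartAdditive

variable {t : TStructure D} {f : D → G}

theorem map_isZero (hf : IsHeartAdditive t f) {X : D} (hX : IsZero X) : f X = 0 := by
  have := hf (t.heart_of_isZero hX) (t.heart_of_isZero hX) (Dist.id_zero X hX)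
  simpa using this

theorem map_iso (hf : IsHeartAdditive t f) {X Y : D} (e : X ≅ Y) (hX : t.heart X) :
    f X = f Y := by
  have := hf hX (t.heart_of_isZero (isZero_zero D))
    (Dist.of_isIso_left e.hom (isZero_zero D))
  rw [this, hf.map_isZero (isZero_zero D), add_zero]

end IsHeartAdditive

namespace EulerChar

variable (t : TStructure D) (f : D → G)

/-- The objects concentrated in degree `n`. -/
def IsPure (n : ℤ) (P : D) : Prop := t.IsLE P n ∧ t.IsGE P n

/-- The Euler characteristic of an object concentrated in degree `n`. -/
def pureVal (n : ℤ) (P : D) : G := n.negOnePow • f (P⟦n⟧)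

variable {t f}

theorem IsPure.heart {n : ℤ} {P : D} (hP : IsPure t n P) : t.heart (P⟦n⟧) := by
  have := hP.1
  have := hP.2
  exact (t.mem_heart_iff _).2 ⟨t.isLE_shift P n n 0, t.isGE_shift P n n 0⟩

theorem IsPure.of_dist {n : ℤ} {X Y Z : D} {a : X ⟶ Y} {b : Y ⟶ Z} (h : Dist a b)
    (hX : IsPure t n X) (hZ : IsPure t n Z) : IsPure t n Y :=
  ⟨t.isLE_of_dist h n hX.1 hZ.1, t.isGE_of_dist h n hX.2 hZ.2⟩

theorem IsPure.shift {n : ℤ} {P : D} (hP : IsPure t n P) : IsPure t (n + 1) (P⟦(-1 : ℤ)⟧) := by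
  have := hP.1
  have := hP.2
  exact ⟨t.isLE_shift P n (-1) (n + 1), t.isGE_shift P n (-1) (n + 1)⟩

variable (hf : IsHeartAdditive t f)
include hf

theorem pureVal_add {n : ℤ} {X Y Z : D} {a : X ⟶ Y} {b : Y ⟶ Z} (h : Dist a b)
    (hX : IsPure t n X) (hZ : IsPure t n Z) : pureVal f n Y = pureVal f n X + pureVal f n Z := by
  obtain ⟨a', b', h'⟩ := h.shift n
  rw [pureVal, hf hX.heart hZ.heart h', smul_add]
  rfl

theorem pureVal_isZero {n : ℤ} {X : D} (hX : IsZero X) : pureVal f n X = 0 := by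
  rw [pureVal, hf.map_isZero ((shiftFunctor D n).map_isZero hX), smul_zero]

theorem pureVal_iso {n : ℤ} {X Y : D} (e : X ≅ Y) (hX : IsPure t n X) :
    pureVal f n X = pureVal f n Y := by
  rw [pureVal, pureVal, hf.map_iso ((shiftFunctor D n).mapIso e) hX.heart]

theorem pureVal_shift {n : ℤ} {X : D} (hX : IsPure t n X) :
    pureVal f (n + 1) (X⟦(-1 : ℤ)⟧) = -pureVal f n X := by
  rw [pureVal, pureVal, Int.negOnePow_succ, Units.neg_smul,
    hf.map_iso ((shiftFunctorAdd' D (-1 : ℤ) (n + 1) n (by omega)).app X) hX.heart]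
  rfl

omit hf in
variable (t f) in
/-- `EulerChar.HasValue t f n X g`: the object `X` has cohomology in degrees `≤ n`, and its Euler
characteristic with respect to `f` is `g`. -/
inductive HasValue : ℤ → D → G → Prop
  | zero {n : ℤ} {X : D} (hX : IsZero X) : HasValue n X 0
  | step {m n : ℤ} {W X P : D} {a : W ⟶ X} {b : X ⟶ P} {g : G} (hmn : m + 1 = n) (h : Dist a b)
      (hP : IsPure t n P) (hW : HasValue m W g) : HasValue n X (g + pureVal f n P)

namespace HasValue

omit hf in
theorem isLE {n : ℤ} {X : D} {g : G} (h : HasValue t f n X g) : t.IsLE X n := by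
  induction h with
  | zero hX => exact t.isLE_of_isZero hX _
  | @step m n W X P a b g hmn h hP hW ih =>
    exact t.isLE_of_dist h n (t.isLE_of_le W m n) hP.1

omit hf in
theorem iso {n : ℤ} {X Y : D} {g : G} (h : HasValue t f n X g) (e : X ≅ Y) :
    HasValue t f n Y g := by
  cases h with
  | zero hX => exact zero (hX.of_iso e.symm)
  | step hmn h hP hW => exact step hmn (h.isoMiddle e) hP hW

theorem eq_zero {n : ℤ} {X : D} {g : G} (h : HasValue t f n X g) (hX : IsZero X) : g = 0 := by
  induction h with
  | zero => rfl
  | @step m n W X P a b g hmn h hP hW ih =>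
    have := hW.isLE
    have := hP.2
    have := t.isLE_cone h m (t.isLE_of_le W m (m + 1)) (t.isLE_of_isZero hX m)
    have hP' : IsZero P := t.isZero P m n
    have hW' : IsZero W := by
      have := h.isIso_left hP'
      exact hX.of_iso (asIso a)
    rw [ih hW', pureVal_isZero hf hP', add_zero]

/-- Truncation triangles are unique up to isomorphism, so the top cohomology and the remainder are
determined by `X`. -/
theorem unique {n : ℤ} {X : D} {g g' : G} (h : HasValue t f n X g)
    (h' : HasValue t f n X g') : g = g' := by
  induction h generalizing g' with
  | zero hX => exact (h'.eq_zero hf hX).symm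
  | @step m n W X P a b g hmn h hP hW ih =>
    have hX := h
    cases h' with
    | zero h0 => exact (step hmn h hP hW).eq_zero hf h0
    | @step m' _ W' _ P' a' b' g' hmn' h' hP' hW' =>
      obtain rfl : m' = m := by omega
      obtain ⟨c, hc⟩ := h
      obtain ⟨c', hc'⟩ := h'
      obtain ⟨e, -⟩ := t.triangle_iso_exists hc hc' (Iso.refl _) m' n hW.isLE hP.2 hW'.isLE hP'.2
      rw [ih (hW'.iso (Triangle.π₁.mapIso e).symm), pureVal_iso hf (show P ≅ P' from Triangle.π₃.mapIso e) hP]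

theorem succ {n : ℤ} {X : D} {g : G} (h : HasValue t f n X g) : HasValue t f (n + 1) X g := by
  have := step rfl (Dist.id_zero X (isZero_zero D))
    ⟨t.isLE_of_isZero (isZero_zero D) (n + 1), t.isGE_of_isZero (isZero_zero D) (n + 1)⟩ h
  rwa [pureVal_isZero hf (isZero_zero D), add_zero] at this

theorem mono {n n' : ℤ} (hn : n ≤ n') {X : D} {g : G} (h : HasValue t f n X g) :
    HasValue t f n' X g := by
  obtain ⟨k, rfl⟩ := Int.le.dest hn
  induction k with
  | zero => simpa using h
  | succ k ih =>
    have := (ih (by omega)).succ hf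
    rwa [add_assoc] at this

theorem shift {n : ℤ} {X : D} {g : G} (h : HasValue t f n X g) :
    HasValue t f (n + 1) (X⟦(-1 : ℤ)⟧) (-g) := by
  induction h with
  | zero hX => simpa using zero ((shiftFunctor D (-1 : ℤ)).map_isZero hX)
  | @step m n W X P a b g hmn h hP hW ih =>
    obtain ⟨a', b', h'⟩ := h.shift (-1)
    have := step (by omega) h' hP.shift ih
    rwa [pureVal_shift hf hP, ← neg_add] at this

variable [IsTriangulated D]

/-- An octahedron merges `P` with the top cohomology of `X` into one object of degree `n`, leaving
the lower part of `X` unchanged. -/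
theorem extend {n : ℤ} {X Y P : D} {a : X ⟶ Y} {b : Y ⟶ P} {g : G} (h : HasValue t f n X g)
    (hab : Dist a b) (hP : IsPure t n P) : HasValue t f n Y (g + pureVal f n P) := by
  cases h with
  | zero hX =>
    have := hab.isIso_right hX
    exact step (sub_add_cancel n 1) (Dist.of_isIso_right b hX) hP (zero hX)
  | @step m _ W _ P' a' b' g hmn h hP' hW =>
    obtain ⟨C, c, m₁, m₃, h₁, h₂, -, -⟩ := h.octahedron hab
    have := step hmn h₁ (hP'.of_dist h₂ hP) hW
    rwa [pureVal_add hf h₂ hP' hP, ← add_assoc] at this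

end HasValue

omit hf

/-- Induction on `k`, a bound for the number of degrees from `a` to `n`: one degree is truncated off
each time. -/
theorem exists_hasValue (k : ℕ) : ∀ {a n : ℤ} {X : D}, n < a + k → t.IsLE X n → t.IsGE X a →
    ∃ g, HasValue t f n X g := by
  induction k with
  | zero =>
    intro a n X hn h₁ h₂
    exact ⟨0, .zero (t.isZero X n a (by simpa using hn))⟩
  | succ k ih =>
    intro a n X hn h₁ h₂
    by_cases hna : n < a
    · exact ⟨0, .zero (t.isZero X n a hna)⟩
    obtain ⟨W, P, u, v, hW, hP, h⟩ := t.exists_dist X (n - 1) n (by simp)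
    obtain ⟨g, hg⟩ := ih (a := a) (n := n - 1) (X := W) (by push_cast at hn; omega) hW
      (t.isGE_fibre h a h₂ (t.isGE_of_ge P (a - 1) n))
    exact ⟨_, .step (by simp) h ⟨t.isLE_cone h n (t.isLE_of_le W (n - 1) (n + 1)) h₁, hP⟩ hg⟩

open scoped Classical in
variable (t f) in
/-- The Euler characteristic of a bounded object. -/
def value (X : D) : G := if h : ∃ g n, HasValue t f n X g then h.choose else 0

include hf

theorem HasValue.value_eq {n : ℤ} {X : D} {g : G} (h : HasValue t f n X g) :
    value t f X = g := by
  have hex : ∃ g n, HasValue t f n X g := ⟨g, n, h⟩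
  rw [value, dif_pos hex]
  obtain ⟨n', h'⟩ := hex.choose_spec
  exact (h'.mono hf (le_max_left n' n)).unique hf (h.mono hf (le_max_right n' n))

theorem value_isZero {X : D} (hX : IsZero X) : value t f X = 0 :=
  (HasValue.zero (n := 0) hX).value_eq hf

omit hf in
theorem exists_hasValue_of_bounded {X : D} (hX : t.bounded X) : ∃ n g, HasValue t f n X g := by
  obtain ⟨⟨a, ha⟩, ⟨n, hn⟩⟩ := hX
  obtain ⟨g, hg⟩ := exists_hasValue (t := t) (f := f) (n - a + 1).toNat (a := a) (n := n)
    (by omega) hn ha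
  exact ⟨n, g, hg⟩

theorem value_iso {X Y : D} (hX : t.bounded X) (e : X ≅ Y) : value t f X = value t f Y := by
  obtain ⟨n, g, hg⟩ := exists_hasValue_of_bounded (f := f) hX
  rw [hg.value_eq hf, (hg.iso e).value_eq hf]

theorem value_shift {X : D} (hX : t.bounded X) :
    value t f (X⟦(-1 : ℤ)⟧) = -value t f X := by
  obtain ⟨n, g, hg⟩ := exists_hasValue_of_bounded (f := f) hX
  rw [hg.value_eq hf, (hg.shift hf).value_eq hf]

theorem value_shift_one {X : D} (hX : t.bounded X) :
    value t f (X⟦(1 : ℤ)⟧) = -value t f X := by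
  have h := value_shift hf (X := X⟦(1 : ℤ)⟧) (t.bounded.le_shift 1 X hX)
  rw [← value_iso hf hX (shiftShiftNeg X (1 : ℤ)).symm] at h
  rw [h, neg_neg]

theorem value_heart {X : D} (hX : t.heart X) : value t f X = f X := by
  have hX' := (t.mem_heart_iff X).1 hX
  have := HasValue.step (f := f) (n := 0) (m := -1) (by simp)
    (Dist.zero_id X (isZero_zero D)) hX' (.zero (isZero_zero D))
  rw [this.value_eq hf, zero_add, pureVal, Int.negOnePow_zero, one_smul,
    hf.map_iso (show X ≅ X⟦(0 : ℤ)⟧ from (shiftFunctorZero D ℤ).symm.app X) hX]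

variable [IsTriangulated D]

theorem value_extend {n : ℤ} {X Y P : D} {a : X ⟶ Y} {b : Y ⟶ P} (hX : t.bounded X)
    (hXn : t.IsLE X n) (hab : Dist a b) (hP : IsPure t n P) :
    value t f Y = value t f X + pureVal f n P := by
  obtain ⟨⟨c, hc⟩, -⟩ := hX
  obtain ⟨g, hg⟩ := exists_hasValue (t := t) (f := f) (n - c + 1).toNat (a := c) (n := n)
    (by omega) hXn hc
  rw [hg.value_eq hf, (hg.extend hf hab hP).value_eq hf]

/-- Removing the top cohomology of the third object of a triangle. -/
theorem exists_truncation {n : ℤ} {X Y Z : D} {u : X ⟶ Y} {v : Y ⟶ Z} (h : Dist u v)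
    (hX : t.IsLE X n) (hZ : t.IsLE Z n) (hYb : t.bounded Y) (hZb : t.bounded Z) :
    ∃ (Y' Z' : D) (u' : X ⟶ Y') (v' : Y' ⟶ Z'), Dist u' v' ∧ t.IsLE Y' n ∧ t.IsLE Z' (n - 1) ∧
      (∀ b, b ≤ n + 1 → t.IsGE Y b → t.IsGE Y' b) ∧ (∀ b, b ≤ n + 1 → t.IsGE Z b → t.IsGE Z' b) ∧
      value t f Y - value t f Y' = value t f Z - value t f Z' := by
  obtain ⟨Z', P, a, b, hZ', hP, hab⟩ := t.exists_dist Z (n - 1) n (by simp)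
  have hPP : IsPure t n P := ⟨t.isLE_cone hab n (t.isLE_of_le Z' (n - 1) (n + 1)) hZ, hP⟩
  obtain ⟨Y', y, u', v', h₁, h₂, -, -⟩ := h.octahedron' hab
  have hZn := t.isLE_of_le Z' (n - 1) n
  have hYn := t.isLE_of_dist h₂ n hX hZn
  have hY'b : ∀ b, b ≤ n + 1 → t.IsGE Y b → t.IsGE Y' b := fun b hb hY =>
    t.isGE_fibre h₁ b hY (t.isGE_of_ge P (b - 1) n)
  have hZ'b : ∀ b, b ≤ n + 1 → t.IsGE Z b → t.IsGE Z' b := fun b hb hZ =>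
    t.isGE_fibre hab b hZ (t.isGE_of_ge P (b - 1) n)
  refine ⟨Y', Z', u', v', h₂, hYn, hZ', hY'b, hZ'b, ?_⟩
  obtain ⟨⟨cY, hcY⟩, -⟩ := hYb
  obtain ⟨⟨cZ, hcZ⟩, -⟩ := hZb
  have hY'bdd : t.bounded Y' := ⟨⟨min cY (n + 1), hY'b _ (min_le_right _ _)
    (t.isGE_of_ge Y _ cY (min_le_left _ _))⟩, ⟨n, hYn⟩⟩
  have hZ'bdd : t.bounded Z' := ⟨⟨min cZ (n + 1), hZ'b _ (min_le_right _ _)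
    (t.isGE_of_ge Z _ cZ (min_le_left _ _))⟩, ⟨n, hZn⟩⟩
  rw [value_extend hf hY'bdd hYn h₁ hPP, value_extend hf hZ'bdd hZn hab hPP]
  abel

/-- Induction on the number of degrees involved. The triangle is rotated so that each of `Z`, `Y`,
`X` in turn is its third object, whose top cohomology is removed. The middle object changes its
value by the same amount, so the defect of additivity is preserved. -/
theorem value_add_aux (k : ℕ) : ∀ {a n : ℤ} {X Y Z : D} {u : X ⟶ Y} {v : Y ⟶ Z}, n < a + k →
    Dist u v → t.IsLE X n → t.IsLE Y n → t.IsLE Z n → t.IsGE X a → t.IsGE Y a → t.IsGE Z a →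
    value t f Y = value t f X + value t f Z := by
  induction k with
  | zero =>
    intro a n X Y Z u v hn h hX hY hZ hX' hY' hZ'
    have hna : n < a := by simpa using hn
    rw [value_isZero hf (t.isZero X n a), value_isZero hf (t.isZero Y n a),
      value_isZero hf (t.isZero Z n a), add_zero]
  | succ k ih =>
    intro a n X Y Z u v hn h hX hY hZ hXa hYa hZa
    by_cases hna : n < a
    · rw [value_isZero hf (t.isZero X n a), value_isZero hf (t.isZero Y n a),
        value_isZero hf (t.isZero Z n a), add_zero]
    obtain ⟨Y', Z', u₁, v₁, h₁, hY', hZ', hY'a, hZ'a, e₁⟩ :=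
      exists_truncation hf h hX hZ ⟨⟨a, hYa⟩, n, hY⟩ ⟨⟨a, hZa⟩, n, hZ⟩
    have hY'a := hY'a a (by omega) hYa
    have hZ'a := hZ'a a (by omega) hZa
    obtain ⟨w₁, r₁⟩ := h₁.invRotate
    have hZs := t.isLE_shift Z' (n - 1) (-1) n
    have hZsa := t.isGE_shift Z' a (-1) (a + 1)
    obtain ⟨X', Y'', u₂, v₂, h₂, hX', hY'', hX'a, hY''a, e₂⟩ :=
      exists_truncation hf r₁ hZs hY' ⟨⟨a, hXa⟩, n, hX⟩ ⟨⟨a, hY'a⟩, n, hY'⟩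
    have hX'a := hX'a a (by omega) hXa
    have hY''a := hY''a a (by omega) hY'a
    obtain ⟨w₂, r₂⟩ := h₂.invRotate
    have hYs := t.isLE_shift Y'' (n - 1) (-1) n
    obtain ⟨W, X'', u₃, v₃, h₃, hW, hX'', hWa, hX''a, e₃⟩ :=
      exists_truncation hf r₂ hYs hX' ⟨⟨a + 1, hZsa⟩, n, hZs⟩ ⟨⟨a, hX'a⟩, n, hX'⟩
    have hWa := hWa (a + 1) (by omega) hZsa
    have hX''a := hX''a a (by omega) hX'a
    -- Rotating back gives X'' ⟶ Y'' ⟶ W[1] with all terms in degrees `a` to n - 1. For this `W`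
    -- must be in degrees at least a + 1, which is why `exists_truncation` allows bounds up to n +
    -- 1.
    obtain ⟨w₃, r₃⟩ := h₃.unshift
    obtain ⟨w₄, r₄⟩ := r₃.rotate
    have := ih (a := a) (n := n - 1) (by push_cast at hn; omega) r₄ hX'' hY''
      (t.isLE_shift W n 1 (n - 1)) hX''a hY''a (t.isGE_shift W (a + 1) 1 a)
    rw [value_shift_one hf ⟨⟨a + 1, hWa⟩, n, hW⟩] at this
    rw [value_shift hf ⟨⟨a, hZ'a⟩, n - 1, hZ'⟩] at e₃
    have e₄ : value t f Y - (value t f X + value t f Z) =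
      (value t f Y - value t f Y' - (value t f Z - value t f Z'))
        - (value t f X - value t f X' - (value t f Y' - value t f Y''))
        + (-value t f Z' - value t f W - (value t f X' - value t f X''))
        + (value t f Y'' - (value t f X'' + -value t f W)) := by
      abel
    rw [← sub_eq_zero, e₄, sub_eq_zero.2 e₁, sub_eq_zero.2 e₂, sub_eq_zero.2 e₃,
      sub_eq_zero.2 this]
    simp

/-- An additive function on the heart of a bounded t-structure extends to an additive function on
the triangulated category. -/
theorem isTriangleAdditive_value (ht : IsBoundedTStructure t) :
    IsTriangleAdditive (value t f) := by
  intro X Y Z u v h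
  obtain ⟨⟨a₁, _⟩, ⟨n₁, _⟩⟩ := ht X
  obtain ⟨⟨a₂, _⟩, ⟨n₂, _⟩⟩ := ht Y
  obtain ⟨⟨a₃, _⟩, ⟨n₃, _⟩⟩ := ht Z
  let a := min a₁ (min a₂ a₃)
  let n := max n₁ (max n₂ n₃)
  exact value_add_aux hf (n - a + 1).toNat (a := a) (n := n) (by omega) h
    (t.isLE_of_le X n₁ n) (t.isLE_of_le Y n₂ n) (t.isLE_of_le Z n₃ n)
    (t.isGE_of_ge X a a₁) (t.isGE_of_ge Y a a₂) (t.isGE_of_ge Z a a₃)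

end EulerChar

theorem IsHeartAdditive.exists_extension [IsTriangulated D] {t : TStructure D}
    (ht : IsBoundedTStructure t) {f : D → G} (hf : IsHeartAdditive t f) :
    ∃ F : D → G, IsTriangleAdditive F ∧ ∀ X, t.heart X → F X = f X :=
  ⟨_, EulerChar.isTriangleAdditive_value hf ht, fun _ hX => EulerChar.value_heart hf hX⟩

/-- An additive function that vanishes on the heart of a bounded t-structure vanishes. -/
theorem IsTriangleAdditive.eq_zero_of_heart {t : TStructure D}
    (ht : IsBoundedTStructure t) {F : D → G} (hF : IsTriangleAdditive F)
    (h : ∀ X, t.heart X → F X = 0) (X : D) : F X = 0 := by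
  -- Shifts change `F` only by a sign.
  have key : ∀ (n : ℤ) (X : D), F (X⟦n⟧) = 0 → F X = 0 := by
    have h1 : ∀ Y : D, F (Y⟦(-1 : ℤ)⟧) = -F Y := fun Y => by
      have := hF.map_shift (Y⟦(-1 : ℤ)⟧)
      rw [hF.map_iso (shiftNegShift Y (1 : ℤ))] at this
      rw [← neg_eq_iff_eq_neg, ← this]
    intro n
    induction n using Int.induction_on with
    | zero => exact fun X hX => by rwa [hF.map_iso ((shiftFunctorZero D ℤ).app X)] at hX
    | succ n ih =>
      intro X hX
      refine ih X ?_
      rw [hF.map_iso ((shiftFunctorAdd' D (n : ℤ) 1 (n + 1) rfl).app X)] at hX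
      exact neg_eq_zero.1 ((hF.map_shift _).symm.trans hX)
    | pred n ih =>
      intro X hX
      refine ih X ?_
      rw [hF.map_iso ((shiftFunctorAdd' D (-n : ℤ) (-1) (-n - 1) rfl).app X)] at hX
      exact neg_eq_zero.1 ((h1 _).symm.trans hX)
  -- The zero function serves only to produce a filtration of `X` by objects concentrated in one
  -- degree.
  obtain ⟨n, g, hg⟩ := EulerChar.exists_hasValue_of_bounded (f := fun _ : D => (0 : G)) (ht X)
  induction hg with
  | zero hX => exact hF.map_isZero hX
  | @step m n W X P a b g hmn hab hP hW ih => rw [hF hab, ih, key n P (h _ hP.heart), add_zero]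

end EulerCharacteristic

/-! ### Simple objects of a heart in terms of triangles. -/

section SimpleObjects

variable {D : Type u} [Category.{v} D] [Preadditive D] [HasZeroObject D] [HasShift D ℤ]
  [∀ n : ℤ, (shiftFunctor D n).Additive] [Pretriangulated D] {t : TStructure D}

theorem CategoryTheory.Pretriangulated.Dist.exists_iso_fibre {X X' Y Z : D} {f : X ⟶ Y}
    {f' : X' ⟶ Y} {g : Y ⟶ Z} (h : Dist f g) (h' : Dist f' g) : Nonempty (X ≅ X') := by
  obtain ⟨k, hk⟩ := h
  obtain ⟨k', hk'⟩ := h'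
  let e := isoTriangleOfIso₁₂ _ _ (rot_of_distTriang _ hk) (rot_of_distTriang _ hk')
    (Iso.refl Y) (Iso.refl Z) ((Category.comp_id _).trans (Category.id_comp _).symm)
  exact ⟨(shiftFunctor D (1 : ℤ)).preimageIso
    (show X⟦(1 : ℤ)⟧ ≅ X'⟦(1 : ℤ)⟧ from Triangle.π₃.mapIso e)⟩

theorem CategoryTheory.Triangulated.TStructure.isZero_of_dist_isZero {X Y Z : D} {f : X ⟶ Y}
    {g : Y ⟶ Z} (h : Dist f g) (hX : t.heart X) (hZ : t.heart Z) (hY : IsZero Y) : IsZero Z := by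
  rw [IsZero.iff_id_eq_zero]
  exact TStructure.eq_zero_of_comp_right h hX hZ (hY.eq_of_src _ _)

namespace IsSimpleInHeart

theorem heart {S : D} (hS : IsSimpleInHeart t S) : t.heart S := hS.1

theorem iso {S S' : D} (hS : IsSimpleInHeart t S) (e : S ≅ S') : IsSimpleInHeart t S' := by
  obtain ⟨h, hs⟩ := hS
  exact ⟨t.heart.prop_of_iso e h, Simple.of_iso (Y := ⟨S, h⟩) (t.heart.isoMk e.symm)⟩

theorem not_isZero {S : D} (hS : IsSimpleInHeart t S) : ¬ IsZero S := by
  obtain ⟨h, hs⟩ := hS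
  intro hz
  apply id_nonzero (⟨S, h⟩ : t.heart.FullSubcategory)
  ext
  exact hz.eq_of_src _ _

theorem isZero_or_isZero {S A B : D} (hS : IsSimpleInHeart t S) {f : A ⟶ S} {g : S ⟶ B}
    (h : Dist f g) (hA : t.heart A) (hB : t.heart B) : IsZero A ∨ IsZero B := by
  obtain ⟨hS, hs⟩ := hS
  let f' : (⟨A, hA⟩ : t.heart.FullSubcategory) ⟶ ⟨S, hS⟩ := t.heart.homMk f
  have : Mono f' := Preadditive.mono_of_cancel_zero _ fun {W} k hk => by
    ext
    exact TStructure.eq_zero_of_comp_left h hB W.2 (congrArg (fun l => l.hom) hk)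
  by_cases hf : f' = 0
  · left
    rw [IsZero.iff_id_eq_zero]
    refine TStructure.eq_zero_of_comp_left h hB hA ?_
    rw [show f = 0 from congrArg (fun l => l.hom) hf, comp_zero]
  · right
    have := isIso_of_mono_of_nonzero hf
    have : IsIso f := inferInstanceAs (IsIso (t.heart.ι.map f'))
    exact h.isZero_right this

theorem of_dist {S : D} (hS : t.heart S) (h0 : ¬ IsZero S)
    (h : ∀ (A B : D) (f : A ⟶ S) (g : S ⟶ B), t.heart A → t.heart B → Dist f g →
      IsZero A ∨ IsZero B) : IsSimpleInHeart t S := by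
  refine ⟨hS, ⟨fun {Y} f hf => ?_⟩⟩
  let := t.hasHeartFullSubcategory
  obtain ⟨Q, p, hQ, hd⟩ := t.exists_dist_of_mono f
  constructor
  · rintro hi rfl
    refine h0 ?_
    have h2 : 𝟙 (⟨S, hS⟩ : t.heart.FullSubcategory) = 0 := by
      rw [← IsIso.inv_hom_id (0 : Y ⟶ ⟨S, hS⟩), comp_zero]
    rw [IsZero.iff_id_eq_zero]
    exact congrArg (fun l => l.hom) h2
  · intro hf0
    rcases h _ _ _ _ (t.ιHeart_obj_mem Y) hQ hd with hY | hQ0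
    · refine absurd ?_ hf0
      ext
      exact hY.eq_of_src _ _
    · have := hd.isIso_left hQ0
      exact isIso_of_reflects_iso f t.ιHeart

variable [IsTriangulated D]

theorem exists_dist {K S : D} (hS : IsSimpleInHeart t S) (hK : t.heart K) {f : K ⟶ S}
    (hf : f ≠ 0) : ∃ (W : D) (a : W ⟶ K), t.heart W ∧ Dist a f := by
  obtain ⟨N, I, C, a, p, i, q, hN, hI, hC, h₁, h₂, rfl⟩ := TStructure.exists_image hK hS.heart f
  rcases hS.isZero_or_isZero h₂ hI hC with h0 | h0
  · exact absurd (by rw [h0.eq_of_tgt p 0, zero_comp]) hf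
  · have := h₂.isIso_left h0
    exact ⟨N, a, hN, h₁.isoRight (asIso i)⟩

theorem isIso {S S' : D} (hS : IsSimpleInHeart t S) (hS' : IsSimpleInHeart t S') {f : S ⟶ S'}
    (hf : f ≠ 0) : IsIso f := by
  obtain ⟨W, a, hW, h⟩ := hS'.exists_dist hS.heart hf
  rcases hS.isZero_or_isZero h hW hS'.heart with h0 | h0
  · exact h.isIso_right h0
  · exact absurd h0 hS'.not_isZero

end IsSimpleInHeart

end SimpleObjects

/-! ### The Jordan–Hölder theorem and additive functions on a heart. -/

section JordanHoelder

variable {D : Type u} [Category.{v} D] [Preadditive D] [HasZeroObject D] [HasShift D ℤ]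
  [∀ n : ℤ, (shiftFunctor D n).Additive] [Pretriangulated D] {G : Type w} [AddCommGroup G]

/-- `HasSeries t w X l a`: the object `X` of the heart of `t` has a composition series of length
`l`, and the sum of the weights `w` of its factors is `a`. -/
inductive HasSeries (t : TStructure D) (w : D → G) : D → ℕ → G → Prop
  | zero {X : D} (hX : IsZero X) : HasSeries t w X 0 0
  | step {K X S : D} {k : K ⟶ X} {q : X ⟶ S} {l : ℕ} {a : G} (h : Dist k q)
      (hS : IsSimpleInHeart t S) (hK : HasSeries t w K l a) : HasSeries t w X (l + 1) (a + w S)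

namespace HasSeries

variable {t : TStructure D} {w : D → G}

theorem heart {X : D} {l : ℕ} {a : G} (h : HasSeries t w X l a) : t.heart X := by
  induction h with
  | zero hX => exact t.heart_of_isZero hX
  | step h hS hK ih => exact t.heart_of_dist h ih hS.heart

theorem iso {X Y : D} {l : ℕ} {a : G} (h : HasSeries t w X l a) (e : X ≅ Y) :
    HasSeries t w Y l a := by
  cases h with
  | zero hX => exact zero (hX.of_iso e.symm)
  | step h hS hK => exact step (h.isoMiddle e) hS hK

variable [IsTriangulated D]

theorem add {X Y Z : D} {l m : ℕ} {a b : G} {f : X ⟶ Y} {g : Y ⟶ Z} (h : Dist f g)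
    (hX : HasSeries t w X l a) (hZ : HasSeries t w Z m b) : HasSeries t w Y (l + m) (a + b) := by
  induction hZ generalizing Y with
  | zero hZ =>
    have := h.isIso_left hZ
    simpa using hX.iso (asIso f)
  | step h' hS hK ih =>
    obtain ⟨Y', y, m₁, m₃, h₁, h₂, -, -⟩ := h.octahedron' h'
    have := step h₁ hS (ih h₂)
    rwa [add_assoc, add_assoc] at this

/-- The Jordan–Hölder argument, by induction on the length: two maximal subobjects `K` and `K'`
either agree or are compared through their intersection, to which the factors `S'` and `S` are added
respectively. -/
theorem unique (hw : ∀ S S', IsSimpleInHeart t S → Nonempty (S ≅ S') → w S = w S')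
    (hex : ∀ X, t.heart X → ∃ l a, HasSeries t w X l a) {l : ℕ} :
    ∀ {X : D} {a : G} {l' : ℕ} {a' : G}, HasSeries t w X l a → HasSeries t w X l' a' →
      l = l' ∧ a = a' := by
  have hzero : ∀ {X K S : D} {k : K ⟶ X} {q : X ⟶ S} {l : ℕ} {a : G}, IsZero X → Dist k q →
      IsSimpleInHeart t S → HasSeries t w K l a → False := fun hX h hS hK =>
    hS.not_isZero (TStructure.isZero_of_dist_isZero h hK.heart hS.heart hX)
  induction l with
  | zero =>
    intro X a l' a' h h'
    cases h with
    | zero hX =>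
      cases h' with
      | zero => exact ⟨rfl, rfl⟩
      | step h' hS hK => exact (hzero hX h' hS hK).elim
  | succ l ih =>
    intro X a l' a' hX hX'
    cases hX with
    | @step K _ S k q _ a h hS hK =>
    cases hX' with
    | zero h0 => exact (hzero h0 h hS hK).elim
    | @step K' _ S' k' q' l' a' h' hS' hK' =>
    by_cases hu : k ≫ q' = 0
    · obtain ⟨v, rfl⟩ := h.desc q' hu
      have hv : v ≠ 0 := by
        rintro rfl
        refine hS'.not_isZero ?_
        rw [IsZero.iff_id_eq_zero]
        exact TStructure.eq_zero_of_comp_right h' hK'.heart hS'.heart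
          (by rw [comp_zero, zero_comp])
      have := hS.isIso hS' hv
      obtain ⟨e⟩ := (h.isoRight (asIso v)).exists_iso_fibre h'
      obtain ⟨rfl, rfl⟩ := ih hK (hK'.iso e.symm)
      exact ⟨rfl, by rw [hw S S' hS ⟨asIso v⟩]⟩
    · obtain ⟨W, b, hW, hWK⟩ := hS'.exists_dist hK.heart hu
      obtain ⟨c, hc⟩ := h.invRotate
      -- `Y` is the intersection of `K` and `K'`: the fibre of K ⟶ S' and also the fibre of a map K'
      -- ⟶ S.
      obtain ⟨Y, y, m₁, m₃, h₁, h₂, -, -⟩ := hc.octahedron' h'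
      obtain ⟨s, hs⟩ := h₂.unshift
      obtain ⟨e⟩ := hWK.exists_iso_fibre h₁
      obtain ⟨p, d, hp⟩ := hex Y (t.heart.prop_of_iso e hW)
      obtain ⟨hl, ha⟩ := ih hK (step h₁ hS' hp)
      subst hl
      obtain ⟨hl', ha'⟩ := ih (step hs hS hp) hK'
      subst hl'
      exact ⟨rfl, by rw [ha, ← ha']; abel⟩

end HasSeries

variable [IsTriangulated D] {t : TStructure D} {w : D → G}

/-- The function is the sum of the weights over a composition series; concatenating series makes it
additive. -/
theorem exists_isHeartAdditive
    (hw : ∀ S S', IsSimpleInHeart t S → Nonempty (S ≅ S') → w S = w S')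
    (hex : ∀ X, t.heart X → ∃ l a, HasSeries t w X l a) :
    ∃ f : D → G, IsHeartAdditive t f ∧ ∀ S, IsSimpleInHeart t S → f S = w S := by
  classical
  have key : ∀ X, ∃ a, t.heart X → ∃ l, HasSeries t w X l a := fun X => by
    by_cases hX : t.heart X
    · obtain ⟨l, a, h⟩ := hex X hX
      exact ⟨a, fun _ => ⟨l, h⟩⟩
    · exact ⟨0, fun h => absurd h hX⟩
  choose f hf using key
  refine ⟨f, fun X Y Z a b hX hZ h => ?_, fun S hS => ?_⟩
  · obtain ⟨l, hl⟩ := hf X hX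
    obtain ⟨m, hm⟩ := hf Z hZ
    obtain ⟨n, hn⟩ := hf Y (t.heart_of_dist h hX hZ)
    exact (hn.unique hw hex (hl.add h hm)).2
  · obtain ⟨l, hl⟩ := hf S hS.heart
    have := HasSeries.step (w := w) (Dist.zero_id S (isZero_zero D)) hS (.zero (isZero_zero D))
    simpa using (hl.unique hw hex this).2

end JordanHoelder

/-! ### Finite length and the number of simple objects. -/

section Count

variable {D : Type u} [Category.{v} D] [Preadditive D] [HasZeroObject D] [HasShift D ℤ]
  [∀ n : ℤ, (shiftFunctor D n).Additive] [Pretriangulated D] {t : TStructure D}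

/-- An additive function that is at least `1` on the nonzero objects of the heart. -/
structure IsHeartPositive (t : TStructure D) (ℓ : D → ℝ) : Prop where
  additive : IsTriangleAdditive ℓ
  one_le : ∀ X, t.heart X → ¬ IsZero X → 1 ≤ ℓ X

namespace IsHeartPositive

variable {ℓ : D → ℝ} (hℓ : IsHeartPositive t ℓ)
include hℓ

theorem nonneg {X : D} (hX : t.heart X) : 0 ≤ ℓ X := by
  by_cases h : IsZero X
  · rw [hℓ.additive.map_isZero h]
  · linarith [hℓ.one_le X hX h]

/-- Induction on an integer bound for `ℓ`: when a non-simple object is split into two nonzero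
pieces, each of them loses at least 1. -/
theorem exists_hasSeries [IsTriangulated D] {G : Type w} [AddCommGroup G] (w : D → G) (X : D)
    (hX : t.heart X) : ∃ l a, HasSeries t w X l a := by
  have key : ∀ (n : ℕ) (X : D), t.heart X → ℓ X < n → ∃ l a, HasSeries t w X l a := by
    intro n
    induction n with
    | zero => exact fun X hX h => absurd (hℓ.nonneg hX) (by simpa using h)
    | succ n ih =>
      intro X hX h
      by_cases h0 : IsZero X
      · exact ⟨_, _, .zero h0⟩
      by_cases hs : IsSimpleInHeart t X
      · exact ⟨_, _, .step (Dist.zero_id X (isZero_zero D)) hs (.zero (isZero_zero D))⟩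
      obtain ⟨A, B, f, g, hA, hB, hd, hA0, hB0⟩ : ∃ (A B : D) (f : A ⟶ X) (g : X ⟶ B),
          t.heart A ∧ t.heart B ∧ Dist f g ∧ ¬ IsZero A ∧ ¬ IsZero B := by
        by_contra hcon
        refine hs (IsSimpleInHeart.of_dist hX h0 fun A B f g hA hB hd => ?_)
        by_contra hne
        rw [not_or] at hne
        exact hcon ⟨A, B, f, g, hA, hB, hd, hne⟩
      have h1 := hℓ.additive hd
      have h2 := hℓ.one_le A hA hA0
      have h3 := hℓ.one_le B hB hB0
      push_cast at h
      obtain ⟨l, a, hla⟩ := ih A hA (by linarith)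
      obtain ⟨m, b, hmb⟩ := ih B hB (by linarith)
      exact ⟨_, _, hla.add hd hmb⟩
  obtain ⟨n, hn⟩ := exists_nat_gt (ℓ X)
  exact key n X hX hn

/-- The quotient of two different nested subobjects is nonzero and adds at least 1 to `ℓ`, so the
rounded values still increase strictly. -/
theorem strictMono_subobject (X : t.heart.FullSubcategory) :
    StrictMono fun Y : Subobject X => ⌊ℓ (Y : t.heart.FullSubcategory).obj⌋₊ := by
  intro Y Z hYZ
  let := t.hasHeartFullSubcategory
  obtain ⟨Q, p, hQ, hd⟩ := t.exists_dist_of_mono (Subobject.ofLE Y Z hYZ.le)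
  have hQ0 : ¬ IsZero Q := fun h0 => by
    have := hd.isIso_left h0
    have : IsIso (Subobject.ofLE Y Z hYZ.le) := isIso_of_reflects_iso _ t.ιHeart
    refine hYZ.ne (le_antisymm hYZ.le (Subobject.le_of_comm (inv (Subobject.ofLE Y Z hYZ.le)) ?_))
    rw [IsIso.inv_comp_eq, Subobject.ofLE_arrow]
  have h1 : ℓ (Z : t.heart.FullSubcategory).obj = ℓ (Y : t.heart.FullSubcategory).obj + ℓ Q :=
    hℓ.additive hd
  have h2 := hℓ.one_le Q hQ hQ0
  have h3 := hℓ.nonneg (Y : t.heart.FullSubcategory).2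
  change ⌊ℓ (Y : t.heart.FullSubcategory).obj⌋₊ < ⌊ℓ (Z : t.heart.FullSubcategory).obj⌋₊
  rw [← Nat.add_one_le_iff, ← Nat.floor_add_one h3]
  exact Nat.floor_mono (by linarith)

theorem wellFoundedLT (X : t.heart.FullSubcategory) : WellFoundedLT (Subobject X) :=
  (hℓ.strictMono_subobject X).wellFoundedLT

theorem wellFoundedGT (X : t.heart.FullSubcategory) : WellFoundedGT (Subobject X) := by
  have h := hℓ.strictMono_subobject X
  have h' : StrictAnti fun Y : Subobject X =>
      ⌊ℓ ((⊤ : Subobject X) : t.heart.FullSubcategory).obj⌋₊ -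
        ⌊ℓ (Y : t.heart.FullSubcategory).obj⌋₊ := fun Y Z hYZ => by
    have h1 := h hYZ
    have h2 := h.monotone (le_top (a := Z))
    dsimp only at h1 h2 ⊢
    omega
  exact h'.wellFoundedGT

end IsHeartPositive

variable (D) in
/-- The rational vector space of rational-valued additive functions, i.e. the dual of the
Grothendieck group. -/
def additiveFunctions : Submodule ℚ (D → ℚ) where
  carrier := {F | IsTriangleAdditive F}
  zero_mem' := fun _ _ _ _ _ _ => by simp
  add_mem' := fun {F F'} hF hF' _ _ _ _ _ h => by
    simp only [Pi.add_apply, hF h, hF' h]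
    ring
  smul_mem' := fun c F hF _ _ _ _ _ h => by
    simp only [Pi.smul_apply, hF h, smul_add]

variable [IsTriangulated D]

/-- The number of simple objects of the heart is the rank of the Grothendieck group. -/
theorem card_simples_eq_finrank (ht : IsBoundedTStructure t) {ℓ : D → ℝ}
    (hℓ : IsHeartPositive t ℓ) {ι : Type} [Fintype ι] (S : ι → D)
    (hS : ∀ i, IsSimpleInHeart t (S i)) (hinj : ∀ i j, Nonempty (S i ≅ S j) → i = j)
    (hsurj : ∀ X, IsSimpleInHeart t X → ∃ i, Nonempty (X ≅ S i)) :
    Fintype.card ι = Module.finrank ℚ (additiveFunctions D) := by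
  let ev : additiveFunctions D →ₗ[ℚ] (ι → ℚ) :=
    (LinearMap.funLeft ℚ ℚ S).comp (additiveFunctions D).subtype
  have hker : Function.Injective ev := by
    rw [← LinearMap.ker_eq_bot, LinearMap.ker_eq_bot']
    rintro ⟨F, hF⟩ h0
    ext X
    refine IsTriangleAdditive.eq_zero_of_heart ht hF (fun Y hY => ?_) X
    obtain ⟨l, a, h⟩ := hℓ.exists_hasSeries (fun _ : D => (0 : ℚ)) Y hY
    induction h with
    | zero h => exact IsTriangleAdditive.map_isZero hF h
    | @step K X T k q l a h hT hK ih =>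
      obtain ⟨i, ⟨e⟩⟩ := hsurj T hT
      rw [hF h, ih hK.heart, IsTriangleAdditive.map_iso hF e, zero_add]
      exact congrFun h0 i
  have hran : Function.Surjective ev := by
    intro c
    classical
    -- The prescribed values `c` as weights; `hinj` makes them independent of the choice of index.
    let wt : D → ℚ := fun X => if h : ∃ i, Nonempty (X ≅ S i) then c h.choose else 0
    have hwS : ∀ i X, Nonempty (X ≅ S i) → wt X = c i := fun i X ⟨e⟩ => by
      have h : ∃ i, Nonempty (X ≅ S i) := ⟨i, ⟨e⟩⟩
      obtain ⟨e'⟩ := h.choose_spec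
      simp only [wt, dif_pos h]
      rw [hinj _ _ ⟨e'.symm ≪≫ e⟩]
    obtain ⟨f, hf, hfS⟩ := exists_isHeartAdditive (t := t) (w := wt)
      (fun X X' hX ⟨e⟩ => by
        obtain ⟨i, ⟨e'⟩⟩ := hsurj X hX
        rw [hwS i X ⟨e'⟩, hwS i X' ⟨e.symm ≪≫ e'⟩])
      (hℓ.exists_hasSeries wt)
    obtain ⟨F, hF, hFf⟩ := hf.exists_extension ht
    refine ⟨⟨F, hF⟩, funext fun i => ?_⟩
    change F (S i) = c i
    rw [hFf _ (hS i).heart, hfS _ (hS i), hwS i _ ⟨Iso.refl _⟩]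
  rw [(LinearEquiv.ofBijective ev ⟨hker, hran⟩).finrank_eq, Module.finrank_fintype_fun_eq_card]

/-- The number of simples in the conclusion depends on `D` alone. This is what makes it constant
along the green sequence. -/
theorem IsHeartPositive.isAlgebraicHeart (ht : IsBoundedTStructure t) {ℓ : D → ℝ}
    (hℓ : IsHeartPositive t ℓ) {m : ℕ} (E : Fin m → D)
    (hE : ∀ X, IsSimpleInHeart t X → ∃ i, Nonempty (X ≅ E i)) :
    IsAlgebraicHeart t (Module.finrank ℚ (additiveFunctions D)) := by
  classical
  refine ⟨hℓ.wellFoundedLT, hℓ.wellFoundedGT, ?_⟩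
  -- Members of `E` may fail to be simple or be isomorphic to each other, so the index set is the
  -- set of isomorphism classes of the simple ones.
  let J := {i : Fin m // IsSimpleInHeart t (E i)}
  let r : Setoid J :=
    { r := fun i j => Nonempty (E i.1 ≅ E j.1)
      iseqv := ⟨fun _ => ⟨Iso.refl _⟩, fun ⟨e⟩ => ⟨e.symm⟩, fun ⟨e⟩ ⟨e'⟩ => ⟨e ≪≫ e'⟩⟩ }
  let S : Quotient r → D := fun x => E x.out.1
  have hS : ∀ i, IsSimpleInHeart t (S i) := fun i => i.out.2
  have hinj : ∀ i j, Nonempty (S i ≅ S j) → i = j := fun i j h => by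
    rw [← Quotient.out_eq i, ← Quotient.out_eq j]
    exact Quotient.sound h
  have hsurj : ∀ X, IsSimpleInHeart t X → ∃ i, Nonempty (X ≅ S i) := fun X hX => by
    obtain ⟨i, ⟨e⟩⟩ := hE X hX
    let j : J := ⟨i, hX.iso e⟩
    obtain ⟨e'⟩ : Nonempty (S (Quotient.mk r j) ≅ E i) :=
      Quotient.exact (s := r) (Quotient.out_eq (Quotient.mk r j))
    exact ⟨Quotient.mk r j, ⟨e ≪≫ e'.symm⟩⟩
  have hcard := card_simples_eq_finrank ht hℓ S hS hinj hsurj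
  let e := (Fintype.equivFinOfCardEq hcard).symm
  refine ⟨fun i => ⟨S (e i), (hS (e i)).heart⟩, fun i => (hS (e i)).2, fun i j ⟨h⟩ => ?_,
    fun X hX => ?_⟩
  · exact e.injective (hinj _ _ ⟨t.heart.ι.mapIso h⟩)
  · obtain ⟨i, ⟨h⟩⟩ := hsurj X.obj ⟨X.2, hX⟩
    refine ⟨e.symm i, ⟨t.heart.isoMk (h ≪≫ eqToIso ?_)⟩⟩
    change S i = S (e (e.symm i))
    rw [Equiv.apply_symm_apply]

end Count

/-! ### Comparing phases by determinants. -/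

section ComplexArg

/-- The determinant of two complex numbers, as vectors of the real plane. -/
def planeDet (a b : ℂ) : ℝ := a.re * b.im - a.im * b.re

theorem planeDet_eq_sin (a b : ℂ) :
    planeDet a b = ‖a‖ * ‖b‖ * Real.sin (b.arg - a.arg) := by
  rw [planeDet, Real.sin_sub, ← Complex.norm_mul_cos_arg a, ← Complex.norm_mul_cos_arg b,
    ← Complex.norm_mul_sin_arg a, ← Complex.norm_mul_sin_arg b]
  ring

theorem norm_pos_of_arg_pos {a : ℂ} (ha : 0 < a.arg) : 0 < ‖a‖ := by
  rw [norm_pos_iff]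
  rintro rfl
  simp at ha

theorem planeDet_pos {a b : ℂ} (ha : 0 < a.arg) (hb : 0 < b.arg) (h : a.arg < b.arg) :
    0 < planeDet a b := by
  rw [planeDet_eq_sin]
  refine mul_pos (mul_pos (norm_pos_of_arg_pos ha) (norm_pos_of_arg_pos hb))
    (Real.sin_pos_of_pos_of_lt_pi (by linarith) ?_)
  linarith [Complex.arg_le_pi b]

theorem planeDet_comm (a b : ℂ) : planeDet a b = -planeDet b a := by
  simp only [planeDet]
  ring

/-- Both arguments lie in (0, π], so their difference lies strictly between -π and π, where the sine
has the sign of its argument. -/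
theorem arg_lt_arg_iff {a b : ℂ} (ha : 0 < a.arg) (hb : 0 < b.arg) :
    a.arg < b.arg ↔ 0 < planeDet a b := by
  refine ⟨planeDet_pos ha hb, fun h => ?_⟩
  by_contra hlt
  rcases (not_lt.1 hlt).lt_or_eq with h' | h'
  · have := planeDet_pos hb ha h'
    rw [planeDet_comm] at this
    linarith
  · rw [planeDet_eq_sin, h', sub_self, Real.sin_zero, mul_zero] at h
    exact lt_irrefl _ h

theorem planeDet_add_right (a b c : ℂ) :
    planeDet a (b + c) = planeDet a b + planeDet a c := by
  simp only [planeDet, Complex.add_re, Complex.add_im]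
  ring

theorem planeDet_add_left (a b c : ℂ) :
    planeDet (a + b) c = planeDet a c + planeDet b c := by
  simp only [planeDet, Complex.add_re, Complex.add_im]
  ring

theorem planeDet_self (a : ℂ) : planeDet a a = 0 := by
  simp only [planeDet]
  ring

end ComplexArg

/-! ### Extension closures. -/

section ExtCl

variable {D : Type u} [Category.{v} D] [Preadditive D] [HasZeroObject D] [HasShift D ℤ]
  [∀ n : ℤ, (shiftFunctor D n).Additive] [Pretriangulated D]

/-- The closure of a class of objects under extensions. -/
inductive ExtCl (P : ObjectProperty D) : ObjectProperty D
  | zero {X : D} (hX : IsZero X) : ExtCl P X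
  | of {X : D} (hX : P X) : ExtCl P X
  | ext {X Y Z : D} {f : X ⟶ Y} {g : Y ⟶ Z} (h : Dist f g) (hX : ExtCl P X) (hZ : ExtCl P Z) :
      ExtCl P Y

namespace ExtCl

variable {P Q : ObjectProperty D}

theorem iso {X Y : D} (hX : ExtCl P X) (e : X ≅ Y) : ExtCl P Y :=
  ext (Dist.of_isIso_left e.hom (isZero_zero D)) hX (zero (isZero_zero D))

instance : (ExtCl P).IsClosedUnderIsomorphisms := ⟨fun e h => h.iso e⟩

theorem mono (h : ∀ X, P X → ExtCl Q X) {X : D} (hX : ExtCl P X) : ExtCl Q X := by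
  induction hX with
  | zero hX => exact zero hX
  | of hX => exact h _ hX
  | ext h _ _ ih₁ ih₂ => exact ext h ih₁ ih₂

theorem le_heart {t : TStructure D} (h : P ≤ t.heart) : ExtCl P ≤ t.heart := by
  intro X hX
  induction hX with
  | zero hX => exact t.heart_of_isZero hX
  | of hX => exact h _ hX
  | ext h _ _ ih₁ ih₂ => exact t.heart_of_dist h ih₁ ih₂

theorem hom_eq_zero_left {Y : D} (h : ∀ X, P X → ∀ f : X ⟶ Y, f = 0) {X : D} (hX : ExtCl P X)
    (f : X ⟶ Y) : f = 0 := by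
  induction hX with
  | zero hX => exact hX.eq_of_src _ _
  | of hX => exact h _ hX f
  | ext hd _ _ ih₁ ih₂ =>
    obtain ⟨l, rfl⟩ := hd.desc f (ih₁ _)
    rw [ih₂ l, comp_zero]

theorem hom_eq_zero_right {X : D} (h : ∀ Y, Q Y → ∀ f : X ⟶ Y, f = 0) {Y : D} (hY : ExtCl Q Y)
    (f : X ⟶ Y) : f = 0 := by
  induction hY with
  | zero hY => exact hY.eq_of_tgt _ _
  | of hY => exact h _ hY f
  | ext hd _ _ ih₁ ih₂ =>
    obtain ⟨l, rfl⟩ := hd.lift f (ih₂ _)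
    rw [ih₁ l, zero_comp]

theorem isZero (h : ∀ X, P X → IsZero X) {X : D} (hX : ExtCl P X) : IsZero X := by
  induction hX with
  | zero hX => exact hX
  | of hX => exact h _ hX
  | ext hd _ _ ih₁ ih₂ => exact hd.isZero₂ ih₁ ih₂

theorem shift (n : ℤ) (h : ∀ X, P X → Q (X⟦n⟧)) {X : D} (hX : ExtCl P X) :
    ExtCl Q (X⟦n⟧) := by
  induction hX with
  | zero hX => exact zero ((shiftFunctor D n).map_isZero hX)
  | of hX => exact of (h _ hX)
  | ext hd _ _ ih₁ ih₂ =>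
    obtain ⟨a, b, hab⟩ := hd.shift n
    exact ext hab ih₁ ih₂

end ExtCl

theorem extensionClosure_iff {S X : D} :
    ExtensionClosure S X ↔ ExtCl (fun Y => Nonempty (Y ≅ S)) X := by
  constructor
  · intro h
    induction h with
    | zero h => exact .zero h
    | of_iso e => exact .of ⟨e⟩
    | ext f g h hT _ _ ih₁ ih₂ => exact .ext ⟨h, hT⟩ ih₁ ih₂
  · intro h
    induction h with
    | zero h => exact .zero h
    | of h => exact .of_iso h.some
    | ext h _ _ ih₁ ih₂ =>
      obtain ⟨k, hk⟩ := h
      exact .ext _ _ k hk ih₁ ih₂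

/-- The objects isomorphic to a member `E i` of a family with `p i`. -/
def members {m : ℕ} (E : Fin m → D) (p : Fin m → Prop) : ObjectProperty D :=
  fun X => ∃ i, p i ∧ Nonempty (X ≅ E i)

theorem extCl_members_mono {m : ℕ} {E : Fin m → D} {p q : Fin m → Prop} (h : ∀ i, p i → q i)
    {X : D} (hX : ExtCl (members E p) X) : ExtCl (members E q) X :=
  hX.mono fun _ ⟨i, hi, e⟩ => .of ⟨i, h i hi, e⟩

theorem extCl_member {m : ℕ} {E : Fin m → D} {p : Fin m → Prop} {i : Fin m} (hi : p i) :
    ExtCl (members E p) (E i) := .of ⟨i, hi, ⟨Iso.refl _⟩⟩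

end ExtCl

/-! ### Stable objects, sorted filtrations and the torsion pairs they generate. -/

section Stability

variable {D : Type u} [Category.{v} D] [Preadditive D] [HasZeroObject D] [HasShift D ℤ]
  [∀ n : ℤ, (shiftFunctor D n).Additive] [Pretriangulated D]

/-- Stable objects of the heart, with respect to a function `z` on the objects. -/
structure IsStableInHeart (t : TStructure D) (z : D → ℂ) (X : D) : Prop where
  heart : t.heart X
  not_isZero : ¬ IsZero X
  arg_lt : ∀ ⦃A B : D⦄ ⦃f : A ⟶ X⦄ ⦃g : X ⟶ B⦄, t.heart A → t.heart B → Dist f g →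
    ¬ IsZero A → ¬ IsZero B → (z A).arg < (z X).arg

/-- A central charge `z` on the heart of `t` whose stable objects are the `E k`, in order of
decreasing phase, together with a length function `μ` for the heart. -/
structure IsStableSequence (t : TStructure D) (z : D → ℂ) (μ : D → ℕ) {m : ℕ} (E : Fin m → D) :
    Prop where
  additive : IsTriangleAdditive z
  arg_pos : ∀ X, t.heart X → ¬ IsZero X → 0 < (z X).arg
  length_left : ∀ ⦃X Y Z : D⦄ ⦃f : X ⟶ Y⦄ ⦃g : Y ⟶ Z⦄, t.heart X → t.heart Z → Dist f g →
    ¬ IsZero Z → μ X < μ Y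
  length_right : ∀ ⦃X Y Z : D⦄ ⦃f : X ⟶ Y⦄ ⦃g : Y ⟶ Z⦄, t.heart X → t.heart Z → Dist f g →
    ¬ IsZero X → μ Z < μ Y
  stable : ∀ k, IsStableInHeart t z (E k)
  exhaustive : ∀ X, IsStableInHeart t z X → ∃ k, Nonempty (X ≅ E k)
  strictAnti : StrictAnti fun k => (z (E k)).arg

/-- Objects with a filtration whose factors are among the `E i`, `k ≤ i`, in increasing order of
the indices. -/
inductive SortedFiltration {m : ℕ} (E : Fin m → D) : ℕ → D → Prop
  | zero {k : ℕ} {X : D} (hX : IsZero X) : SortedFiltration E k X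
  | cons {k : ℕ} {i : Fin m} {X Y : D} {f : E i ⟶ X} {g : X ⟶ Y} (hki : k ≤ i) (h : Dist f g)
      (hY : SortedFiltration E i Y) : SortedFiltration E k X

theorem SortedFiltration.extCl {m : ℕ} {E : Fin m → D} {k : ℕ} {X : D}
    (h : SortedFiltration E k X) : ExtCl (members E fun i => k ≤ i) X := by
  induction h with
  | zero hX => exact .zero hX
  | cons hki h hY ih => exact .ext h (extCl_member hki) (extCl_members_mono (fun _ => hki.trans) ih)

/-- The filtration is cut at the first factor of index at least `l`; octahedra collect the factors
before the cut into `A`. -/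
theorem SortedFiltration.exists_dist [IsTriangulated D] {m : ℕ} {E : Fin m → D} {k : ℕ} {X : D}
    (h : SortedFiltration E k X) (l : ℕ) : ∃ (A B : D) (f : A ⟶ X) (g : X ⟶ B),
      ExtCl (members E fun i => k ≤ i ∧ i < l) A ∧ ExtCl (members E fun i => l ≤ i) B ∧
        Dist f g := by
  induction h with
  | @zero k X hX => exact ⟨X, X, 𝟙 X, 0, .zero hX, .zero hX, Dist.id_zero X hX⟩
  | @cons k i X Y f g hki h hY ih =>
    by_cases hl : l ≤ i
    · exact ⟨_, X, 0, 𝟙 X, .zero (isZero_zero D), extCl_members_mono (fun _ hj => hl.trans hj)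
        (SortedFiltration.cons le_rfl h hY).extCl, Dist.zero_id X (isZero_zero D)⟩
    · obtain ⟨A, B, a, b, hA, hB, hab⟩ := ih
      obtain ⟨C, c, m₁, m₃, h₁, h₂, -, -⟩ := h.octahedron' hab
      exact ⟨C, B, c, g ≫ b, .ext h₂ (extCl_member ⟨hki, not_le.1 hl⟩)
        (extCl_members_mono (fun _ hj => ⟨hki.trans hj.1, hj.2⟩) hA), hB, h₁⟩

namespace IsStableSequence

variable {t : TStructure D} {z : D → ℂ} {μ : D → ℕ} {m : ℕ} {E : Fin m → D}
  (hE : IsStableSequence t z μ E)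
include hE

/-- The see-saw property: since z Y = z X + z Z, the determinants of the three pairs coincide. -/
theorem arg_lt_iff_lt {X Y Z : D} {f : X ⟶ Y} {g : Y ⟶ Z} (h : Dist f g) (hX : t.heart X)
    (hZ : t.heart Z) (hX0 : ¬ IsZero X) (hZ0 : ¬ IsZero Z) :
    ((z X).arg < (z Y).arg ↔ (z Y).arg < (z Z).arg) ∧
      ((z X).arg < (z Y).arg ↔ (z X).arg < (z Z).arg) := by
  have hY0 : ¬ IsZero Y := fun h0 => hZ0 (TStructure.isZero_of_dist_isZero h hX hZ h0)
  have hx := hE.arg_pos X hX hX0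
  have hy := hE.arg_pos Y (t.heart_of_dist h hX hZ) hY0
  have hz := hE.arg_pos Z hZ hZ0
  rw [arg_lt_arg_iff hx hy, arg_lt_arg_iff hy hz, arg_lt_arg_iff hx hz, hE.additive h,
    planeDet_add_left, planeDet_add_right, planeDet_self, planeDet_self]
  simp

theorem arg_le_of_quotient {S N I : D} (hS : IsStableInHeart t z S) {f : N ⟶ S} {g : S ⟶ I}
    (h : Dist f g) (hN : t.heart N) (hI : t.heart I) (hI0 : ¬ IsZero I) :
    (z S).arg ≤ (z I).arg := by
  by_cases hN0 : IsZero N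
  · rw [hE.additive h, hE.additive.map_isZero hN0, zero_add]
  · exact ((hE.arg_lt_iff_lt h hN hI hN0 hI0).1.1 (hS.arg_lt hN hI h hN0 hI0)).le

theorem arg_le_of_sub {S C I : D} (hS : IsStableInHeart t z S) {f : I ⟶ S} {g : S ⟶ C}
    (h : Dist f g) (hI : t.heart I) (hC : t.heart C) (hI0 : ¬ IsZero I) :
    (z I).arg ≤ (z S).arg := by
  by_cases hC0 : IsZero C
  · rw [hE.additive h, hE.additive.map_isZero hC0, add_zero]
  · exact (hS.arg_lt hI hC h hI0 hC0).le

theorem lt_of_arg_lt {i j : Fin m} (h : (z (E i)).arg < (z (E j)).arg) : j < i :=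
  hE.strictAnti.lt_iff_gt.1 h

variable [IsTriangulated D]

/-- An unstable object has a proper subobject of at least its phase. Passing to it shortens the
object, so the process ends at a stable one. -/
theorem exists_stable_sub {X : D} (hX : t.heart X) (hX0 : ¬ IsZero X) :
    ∃ (k : Fin m) (C : D) (f : E k ⟶ X) (g : X ⟶ C), t.heart C ∧ Dist f g ∧
      (z X).arg ≤ (z (E k)).arg := by
  induction hn : μ X using Nat.strong_induction_on generalizing X with
  | _ n ih =>
  by_cases hs : IsStableInHeart t z X
  · obtain ⟨k, ⟨e⟩⟩ := hE.exhaustive X hs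
    exact ⟨k, _, e.inv, 0, t.heart_of_isZero (isZero_zero D),
      Dist.of_isIso_left e.inv (isZero_zero D), (congrArg _ (hE.additive.map_iso e)).le⟩
  · obtain ⟨A, B, f, g, hA, hB, h, hA0, hB0, hle⟩ : ∃ (A B : D) (f : A ⟶ X) (g : X ⟶ B),
        t.heart A ∧ t.heart B ∧ Dist f g ∧ ¬ IsZero A ∧ ¬ IsZero B ∧
          (z X).arg ≤ (z A).arg := by
      by_contra hcon
      refine hs ⟨hX, hX0, fun A B f g hA hB h hA0 hB0 => ?_⟩
      by_contra hlt
      exact hcon ⟨A, B, f, g, hA, hB, h, hA0, hB0, not_lt.1 hlt⟩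
    obtain ⟨k, C, a, b, hC, hd, hk⟩ := ih _ (hn ▸ hE.length_left hA hB h hB0) hA hA0 rfl
    obtain ⟨Q, q, m₁, m₃, h₁, h₂, -, -⟩ := hd.octahedron h
    exact ⟨k, Q, a ≫ f, q, t.heart_of_dist h₂ hC hB, h₁, hle.trans hk⟩

/-- A subobject of `X` of larger phase than `E i` receives a nonzero map from an earlier `E j`. -/
theorem exists_hom_ne_zero {X Y Z : D} {f : X ⟶ Y} {g : Y ⟶ Z} (h : Dist f g) (hX : t.heart X)
    (hZ : t.heart Z) (hX0 : ¬ IsZero X) {i : Fin m} (hi : (z (E i)).arg < (z X).arg) :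
    ∃ (j : Fin m) (k : E j ⟶ Y), j < i ∧ k ≠ 0 := by
  obtain ⟨j, C, a, b, hC, hd, hj⟩ := hE.exists_stable_sub hX hX0
  refine ⟨j, a ≫ f, hE.lt_of_arg_lt (hi.trans_le hj), fun h0 => (hE.stable j).not_isZero ?_⟩
  have ha : a = 0 := TStructure.eq_zero_of_comp_left h hZ (hE.stable j).heart h0
  rw [IsZero.iff_id_eq_zero]
  exact TStructure.eq_zero_of_comp_left hd hC (hE.stable j).heart (by rw [ha, comp_zero])

/-- The image of a nonzero map would have phase at least that of `E i`, as a quotient, and at most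
that of `E j`, as a subobject. -/
theorem hom_eq_zero {i j : Fin m} (hij : i < j) (f : E i ⟶ E j) : f = 0 := by
  by_contra hf
  obtain ⟨N, I, C, a, p, q, c, hN, hI, hC, h₁, h₂, rfl⟩ :=
    TStructure.exists_image (hE.stable i).heart (hE.stable j).heart f
  have hI0 : ¬ IsZero I := fun h0 => hf (by rw [h0.eq_of_tgt p 0, zero_comp])
  exact absurd ((hE.arg_le_of_quotient (hE.stable i) h₁ hN hI hI0).trans
    (hE.arg_le_of_sub (hE.stable j) h₂ hI hC hI0)) (not_le.2 (hE.strictAnti hij))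

/-- Let `i` be the least index with a nonzero map E i ⟶ X. By minimality this map is a monomorphism,
and its cokernel receives no nonzero map from an earlier stable object. Induction on the length then
applies to the cokernel, starting at `i`. -/
theorem sortedFiltration {X : D} (hX : t.heart X) {k : ℕ}
    (h : ∀ i : Fin m, (i : ℕ) < k → ∀ f : E i ⟶ X, f = 0) : SortedFiltration E k X := by
  induction hn : μ X using Nat.strong_induction_on generalizing X k with
  | _ n ih =>
  by_cases hX0 : IsZero X
  · exact .zero hX0
  have hne : {i : Fin m | ∃ f : E i ⟶ X, f ≠ 0}.Nonempty := by
    obtain ⟨j, C, a, b, hC, hd, -⟩ := hE.exists_stable_sub hX hX0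
    refine ⟨j, a, fun ha => (hE.stable j).not_isZero ?_⟩
    rw [IsZero.iff_id_eq_zero]
    exact TStructure.eq_zero_of_comp_left hd hC (hE.stable j).heart (by rw [ha, comp_zero])
  obtain ⟨i, ⟨f, hf⟩, hmin⟩ := WellFounded.has_min wellFounded_lt _ hne
  have hi : k ≤ i := not_lt.1 fun hlt => hf (h i hlt f)
  have hmin' : ∀ j : Fin m, j < i → ∀ g : E j ⟶ X, g = 0 := fun j hj g => by
    by_contra hg
    exact hmin j ⟨g, hg⟩ hj
  have hSi := hE.stable i
  obtain ⟨N, I, C, a, p, q, c, hN, hI, hC, h₁, h₂, rfl⟩ := TStructure.exists_image hSi.heart hX f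
  have hI0 : ¬ IsZero I := fun h0 => hf (by rw [h0.eq_of_tgt p 0, zero_comp])
  -- Otherwise the image is a proper quotient of the stable `E i`, hence a subobject of `X` of
  -- larger phase, and an earlier stable object maps to `X`.
  have hN0 : IsZero N := by
    by_contra hN0
    obtain ⟨j, g, hj, hg⟩ := hE.exists_hom_ne_zero h₂ hI hC hI0
      ((hE.arg_lt_iff_lt h₁ hN hI hN0 hI0).1.1 (hSi.arg_lt hN hI h₁ hN0 hI0))
    exact hg (hmin' j hj g)
  have := h₁.isIso_right hN0
  have hd : Dist (p ≫ q) c := h₂.isoLeft (asIso p)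
  refine .cons hi hd (ih _ (hn ▸ hE.length_right hSi.heart hC hd hSi.not_isZero) hC
    (fun j hj g => ?_) rfl)
  by_contra hg
  obtain ⟨N', I', C', a', p', q', c', hN', hI', hC', h₁', h₂', rfl⟩ :=
    TStructure.exists_image (hE.stable j).heart hC g
  have hI0' : ¬ IsZero I' := fun h0 => hg (by rw [h0.eq_of_tgt p' 0, zero_comp])
  have hij : (z (E i)).arg < (z I').arg := (hE.strictAnti hj).trans_le
    (hE.arg_le_of_quotient (hE.stable j) h₁' hN' hI' hI0')
  -- `Y` is the preimage in `X` of the image of E j ⟶ C. As an extension of that image by `E i` it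
  -- has larger phase than `E i`, contradicting minimality again.
  obtain ⟨Y, y, m₁, m₃, h₃, h₄, -, -⟩ := hd.octahedron' h₂'
  have hY := t.heart_of_dist h₄ hSi.heart hI'
  have hY0 : ¬ IsZero Y := fun h0 => hI0' (TStructure.isZero_of_dist_isZero h₄ hSi.heart hI' h0)
  obtain ⟨l, g, hl, hg⟩ := hE.exists_hom_ne_zero h₃ hY hC' hY0
    ((hE.arg_lt_iff_lt h₄ hSi.heart hI' hSi.not_isZero hI0').2.2 hij)
  exact hg (hmin' l hl g)

omit [IsTriangulated D] in
theorem members_le_heart (p : Fin m → Prop) : ExtCl (members E p) ≤ t.heart :=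
  ExtCl.le_heart fun _ ⟨i, _, ⟨e⟩⟩ => t.heart.prop_of_iso e.symm (hE.stable i).heart

theorem hom_members_eq_zero {p q : Fin m → Prop} (hpq : ∀ i j, p i → q j → i < j) {X Y : D}
    (hX : ExtCl (members E p) X) (hY : ExtCl (members E q) Y) (f : X ⟶ Y) : f = 0 := by
  refine hX.hom_eq_zero_left (fun X ⟨i, hi, ⟨e⟩⟩ f => ?_) f
  refine hY.hom_eq_zero_right (fun Y ⟨j, hj, ⟨e'⟩⟩ f => ?_) f
  rw [← cancel_epi e.inv, ← cancel_mono e'.hom, hE.hom_eq_zero (hpq i j hi hj)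
    ((e.inv ≫ f) ≫ e'.hom), comp_zero, zero_comp]

/-- The torsion pair generated by the first `k` stable objects. -/
theorem isTorsionPair (k : ℕ) : IsTorsionPair t (ExtCl (members E fun i => (i : ℕ) < k))
    (ExtCl (members E fun i => k ≤ (i : ℕ))) where
  torsion_le := hE.members_le_heart _
  torsionFree_le := hE.members_le_heart _
  hom_eq_zero X Y hX hY f := hE.hom_members_eq_zero
    (fun i j hi hj => Fin.lt_def.2 (hi.trans_le hj)) hX hY f
  exists_triangle X hX := by
    obtain ⟨A, B, f, g, hA, hB, h, hT⟩ :=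
      (hE.sortedFiltration (k := 0) hX fun i hi => absurd hi (Nat.not_lt_zero _)).exists_dist k
    exact ⟨A, B, extCl_members_mono (fun _ => And.right) hA, hB, f, g, h, hT⟩

/-- Tilting at the first `k` stable objects. -/
def tilt (k : ℕ) : TStructure D := (hE.isTorsionPair k).tilt

theorem tilt_heart (k : ℕ) : (hE.tilt k).heart = leftTilt (ExtCl (members E fun i => (i : ℕ) < k))
    (ExtCl (members E fun i => k ≤ (i : ℕ))) :=
  (hE.isTorsionPair k).tilt_heart

theorem torsionFree_of_hom_eq_zero {X : D} (hX : t.heart X) {k : ℕ}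
    (h : ∀ i : Fin m, (i : ℕ) < k → ∀ f : E i ⟶ X, f = 0) :
    ExtCl (members E fun i => k ≤ (i : ℕ)) X :=
  (hE.sortedFiltration hX h).extCl

theorem torsionFree_le_tilt (k : ℕ) {X : D} (hX : ExtCl (members E fun i => k ≤ (i : ℕ)) X) :
    (hE.tilt k).heart X := by
  rw [hE.tilt_heart]
  exact mem_leftTilt (.zero (isZero_zero D)) hX
    (Dist.id_zero X ((shiftFunctor D (-1 : ℤ)).map_isZero (isZero_zero D)))

theorem torsion_shift_le_tilt (k : ℕ) {X : D}
    (hX : ExtCl (members E fun i => (i : ℕ) < k) X) : (hE.tilt k).heart (X⟦(-1 : ℤ)⟧) := by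
  rw [hE.tilt_heart]
  exact mem_leftTilt hX (.zero (isZero_zero D)) (Dist.zero_id _ (isZero_zero D))

end IsStableSequence

end Stability

/-! ### The tilted hearts, their generators, and passing from one to the next. -/

section SimpleTilts

variable {D : Type u} [Category.{v} D] [Preadditive D] [HasZeroObject D] [HasShift D ℤ]
  [∀ n : ℤ, (shiftFunctor D n).Additive] [Pretriangulated D]

instance {m : ℕ} (E : Fin m → D) (p : Fin m → Prop) :
    (members E p).IsClosedUnderIsomorphisms :=
  ⟨fun e ⟨i, hi, ⟨e'⟩⟩ => ⟨i, hi, ⟨e.symm ≪≫ e'⟩⟩⟩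

/-- A simple object cannot be an extension of two nonzero objects. So the simples of a heart are
found among any generators under extensions. -/
theorem IsSimpleInHeart.of_extCl {t : TStructure D} {P : ObjectProperty D}
    [P.IsClosedUnderIsomorphisms] (hP : P ≤ t.heart) {S : D} (hX : ExtCl P S)
    (hS : IsSimpleInHeart t S) : P S := by
  induction hX with
  | zero hX => exact absurd hX hS.not_isZero
  | of hX => exact hX
  | @ext X Y Z f g h hX hZ ih₁ ih₂ =>
    rcases hS.isZero_or_isZero h (ExtCl.le_heart hP _ hX) (ExtCl.le_heart hP _ hZ) with h0 | h0
    · have := h.isIso_right h0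
      exact P.prop_of_iso (asIso g).symm (ih₂ (hS.iso (asIso g)))
    · have := h.isIso_left h0
      exact P.prop_of_iso (asIso f) (ih₁ (hS.iso (asIso f).symm))

/-- The generators of the heart obtained by tilting at the first `k` objects of `E`. -/
def tiltGen {m : ℕ} (E : Fin m → D) (k : ℕ) (j : Fin m) : D :=
  if k ≤ j then E j else (E j)⟦(-1 : ℤ)⟧

namespace IsStableSequence

variable {t : TStructure D} {z : D → ℂ} {μ : D → ℕ} {m : ℕ} {E : Fin m → D}
  (hE : IsStableSequence t z μ E)
include hE

theorem central_charge_tiltGen (k : ℕ) (j : Fin m) :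
    z (tiltGen E k j) = if k ≤ (j : ℕ) then z (E j) else -z (E j) := by
  rw [tiltGen]
  split_ifs
  · rfl
  · rw [← hE.additive.map_iso (shiftNegShift (E j) (1 : ℤ)), hE.additive.map_shift, neg_neg]

theorem arg_pos_member (j : Fin m) : 0 < (z (E j)).arg :=
  hE.arg_pos _ (hE.stable j).heart (hE.stable j).not_isZero

/-- Generators that are not shifted have smaller phases than those that are. A ray at an angle `θ`
between the two groups has all charges on one side, because shifting turns the larger phases by π.
-/
theorem exists_planeDet_pos (k : ℕ) : ∃ u : ℂ, ∀ j, 0 < planeDet (z (tiltGen E k j)) u := by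
  classical
  have hpos := hE.arg_pos_member
  have hle := fun j => Complex.arg_le_pi (z (E j))
  -- Bounds for `θ` from the `j`-th generator. Every lower bound is below every upper bound, as all
  -- phases lie in (0, π] and decrease with the index.
  let lo : Fin m → ℝ := fun j =>
    if k ≤ (j : ℕ) then (z (E j)).arg else (z (E j)).arg - Real.pi
  let hi : Fin m → ℝ := fun j =>
    if k ≤ (j : ℕ) then (z (E j)).arg + Real.pi else (z (E j)).arg
  obtain ⟨θ, h₁, h₂⟩ := Order.exists_between_finsets (Finset.univ.image lo)
    (Finset.univ.image hi) (by
      simp only [Finset.mem_image, Finset.mem_univ, true_and, forall_exists_index,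
        forall_apply_eq_imp_iff]
      intro i j
      have := hpos i
      have := hpos j
      have := hle i
      have := hle j
      simp only [lo, hi]
      split_ifs with hi hj hj
      · linarith
      · exact hE.strictAnti (Fin.lt_def.2 (by omega))
      · linarith
      · linarith)
  simp only [Finset.mem_image, Finset.mem_univ, true_and, forall_exists_index,
    forall_apply_eq_imp_iff] at h₁ h₂
  refine ⟨⟨Real.cos θ, Real.sin θ⟩, fun j => ?_⟩
  have hn := norm_pos_of_arg_pos (hpos j)
  have key : planeDet (z (E j)) ⟨Real.cos θ, Real.sin θ⟩ =
      ‖z (E j)‖ * Real.sin (θ - (z (E j)).arg) := by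
    rw [planeDet, Real.sin_sub, ← Complex.norm_mul_cos_arg (z (E j)),
      ← Complex.norm_mul_sin_arg (z (E j))]
    ring
  have l₁ := h₁ j
  have l₂ := h₂ j
  simp only [lo, hi] at l₁ l₂
  rw [hE.central_charge_tiltGen]
  split_ifs at l₁ l₂ ⊢
  · rw [key]
    exact mul_pos hn (Real.sin_pos_of_pos_of_lt_pi (by linarith) (by linarith))
  · rw [planeDet, Complex.neg_re, Complex.neg_im,
      show ∀ a b c d : ℝ, -a * b - -c * d = -(a * b - c * d) by intros; ring]
    change 0 < -planeDet _ _
    rw [key, ← mul_neg, ← Real.sin_neg]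
    exact mul_pos hn (Real.sin_pos_of_pos_of_lt_pi (by linarith) (by linarith))

variable [IsTriangulated D]

theorem tiltGen_mem (k : ℕ) (j : Fin m) : (hE.tilt k).heart (tiltGen E k j) := by
  rw [tiltGen]
  split_ifs with h
  · exact hE.torsionFree_le_tilt k (extCl_member h)
  · exact hE.torsion_shift_le_tilt k (extCl_member (not_le.1 h))

theorem members_tiltGen_le (k : ℕ) : members (tiltGen E k) (fun _ => True) ≤ (hE.tilt k).heart :=
  fun _ ⟨j, _, ⟨e⟩⟩ => (hE.tilt k).heart.prop_of_iso e.symm (hE.tiltGen_mem k j)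

theorem extCl_of_tilt_heart {k : ℕ} {X : D} (hX : (hE.tilt k).heart X) :
    ExtCl (members (tiltGen E k) fun _ => True) X := by
  rw [hE.tilt_heart] at hX
  obtain ⟨T, Y, f, g, hT, hY, h⟩ := exists_dist_of_leftTilt hX
  refine .ext h (hY.mono fun Z ⟨j, hj, ⟨e⟩⟩ => .of ⟨j, trivial, ⟨e ≪≫ eqToIso ?_⟩⟩)
    (hT.shift (-1) fun Z ⟨j, hj, ⟨e⟩⟩ =>
      ⟨j, trivial, ⟨(shiftFunctor D (-1 : ℤ)).mapIso e ≪≫ eqToIso ?_⟩⟩)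
  · rw [tiltGen, if_pos hj]
  · rw [tiltGen, if_neg (not_le.2 hj)]

/-- The determinant with `u` is positive on the generators; there are finitely many, so a multiple
of it is at least 1 on each. -/
theorem exists_isHeartPositive (k : ℕ) : ∃ ℓ, IsHeartPositive (hE.tilt k) ℓ := by
  obtain ⟨u, hu⟩ := hE.exists_planeDet_pos k
  -- A sum of positive reciprocals is at least as large as each of them.
  let c : ℝ := ∑ j, (planeDet (z (tiltGen E k j)) u)⁻¹
  let ℓ : D → ℝ := fun X => c * planeDet (z X) u
  have hadd : IsTriangleAdditive ℓ := fun X Y Z f g h => by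
    simp only [ℓ, hE.additive h, planeDet_add_left, mul_add]
  have hgen : ∀ j, 1 ≤ ℓ (tiltGen E k j) := fun j => by
    rw [← inv_mul_cancel₀ (hu j).ne']
    exact mul_le_mul_of_nonneg_right (Finset.single_le_sum
      (f := fun j => (planeDet (z (tiltGen E k j)) u)⁻¹)
      (fun i _ => (inv_pos.2 (hu i)).le) (Finset.mem_univ j)) (hu j).le
  refine ⟨ℓ, hadd, fun X hX => ?_⟩
  have hX' := hE.extCl_of_tilt_heart hX
  clear hX
  induction hX' with
  | zero hX => exact fun h => absurd hX h
  | of hX =>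
    obtain ⟨j, -, ⟨e⟩⟩ := hX
    rw [hadd.map_iso e]
    exact fun _ => hgen j
  | @ext X Y Z f g h _ _ ih₁ ih₂ =>
    intro hY
    rw [hadd h]
    by_cases hX0 : IsZero X
    · have := h.isIso_right hX0
      rw [hadd.map_isZero hX0, zero_add]
      exact ih₂ fun h0 => hY (h0.of_iso (asIso g))
    · by_cases hZ0 : IsZero Z
      · rw [hadd.map_isZero hZ0, add_zero]
        exact ih₁ hX0
      · linarith [ih₁ hX0, ih₂ hZ0]

theorem isAlgebraicHeart_tilt (ht : IsBoundedTStructure t) (k : ℕ) :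
    IsAlgebraicHeart (hE.tilt k) (Module.finrank ℚ (additiveFunctions D)) := by
  obtain ⟨ℓ, hℓ⟩ := hE.exists_isHeartPositive k
  refine hℓ.isAlgebraicHeart ((hE.isTorsionPair k).tilt_isBounded ht) (tiltGen E k) fun X hX => ?_
  obtain ⟨j, -, e⟩ := hX.of_extCl (hE.members_tiltGen_le k) (hE.extCl_of_tilt_heart hX.heart)
  exact ⟨j, e⟩

/-- Relative to the line through z (E k), all generators other than `E k` lie strictly on one side.
An object with charge on the line is therefore built from copies of `E k` only, and `a` counts them.
-/
theorem planeDet_nonpos (k : Fin m) {X : D} (hX : (hE.tilt k).heart X) :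
    planeDet (z (E k)) (z X) ≤ 0 ∧ (planeDet (z (E k)) (z X) = 0 →
      ∃ a : ℕ, z X = a * z (E k) ∧ (a = 0 → IsZero X)) := by
  have hX' := hE.extCl_of_tilt_heart hX
  clear hX
  induction hX' with
  | zero hX =>
    rw [hE.additive.map_isZero hX]
    exact ⟨by simp [planeDet], fun _ => ⟨0, by simp, fun _ => hX⟩⟩
  | of hX =>
    obtain ⟨j, -, ⟨e⟩⟩ := hX
    rw [hE.additive.map_iso e, hE.central_charge_tiltGen]
    rcases lt_trichotomy j k with hj | rfl | hj
    · have := planeDet_pos (hE.arg_pos_member k) (hE.arg_pos_member j) (hE.strictAnti hj)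
      rw [if_neg (not_le.2 (Fin.lt_def.1 hj)), show planeDet (z (E k)) (-z (E j)) =
        -planeDet (z (E k)) (z (E j)) by simp only [planeDet, Complex.neg_re, Complex.neg_im]; ring]
      exact ⟨by linarith, fun h => by linarith⟩
    · rw [if_pos le_rfl, planeDet_self]
      exact ⟨le_rfl, fun _ => ⟨1, by simp, by simp⟩⟩
    · have := planeDet_pos (hE.arg_pos_member j) (hE.arg_pos_member k) (hE.strictAnti hj)
      rw [if_pos (Fin.lt_def.1 hj).le, planeDet_comm]
      exact ⟨by linarith, fun h => by linarith⟩
  | @ext X Y Z f g h _ _ ih₁ ih₂ =>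
    rw [hE.additive h, planeDet_add_right]
    refine ⟨add_nonpos ih₁.1 ih₂.1, fun h0 => ?_⟩
    obtain ⟨a, ha, ha'⟩ := ih₁.2 (by linarith [ih₁.1, ih₂.1])
    obtain ⟨b, hb, hb'⟩ := ih₂.2 (by linarith [ih₁.1, ih₂.1])
    refine ⟨a + b, by rw [ha, hb]; push_cast; ring, fun hab => h.isZero₂ (ha' ?_) (hb' ?_)⟩
    · omega
    · omega

/-- In a triangle A ⟶ E k ⟶ B of the heart the two determinants are nonpositive with sum zero, so
both vanish. The charges of `A` and `B` are then natural multiples of z (E k) adding up to one copy,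
and one of the objects is zero. -/
theorem isSimpleInHeart_tilt (k : Fin m) : IsSimpleInHeart (hE.tilt k) (E k) := by
  refine .of_dist (hE.torsionFree_le_tilt k (extCl_member le_rfl)) (hE.stable k).not_isZero
    fun A B f g hA hB h => ?_
  have ha := hE.planeDet_nonpos k hA
  have hb := hE.planeDet_nonpos k hB
  have hadd := hE.additive h
  have hdet : planeDet (z (E k)) (z A) + planeDet (z (E k)) (z B) = 0 := by
    rw [← planeDet_add_right, ← hadd, planeDet_self]
  obtain ⟨a, ha₁, ha₂⟩ := ha.2 (by linarith [ha.1, hb.1])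
  obtain ⟨b, hb₁, hb₂⟩ := hb.2 (by linarith [ha.1, hb.1])
  have hz : z (E k) ≠ 0 := norm_pos_iff.1 (norm_pos_of_arg_pos (hE.arg_pos_member k))
  rw [ha₁, hb₁, ← add_mul, eq_comm, mul_eq_right₀ hz] at hadd
  have hab : a + b = 1 := by exact_mod_cast hadd
  rcases Nat.eq_zero_or_pos a with h0 | h0
  · exact .inl (ha₂ h0)
  · exact .inr (hb₂ (by omega))

/-- Hom(E k, T[-1]) = 0 because both objects come from one heart, and Hom(E k, B) = 0 by the order
of the indices. -/
theorem mem_heartOrthogonal (k : Fin m) {B X T : D} {f : B ⟶ X} {g : X ⟶ T⟦(-1 : ℤ)⟧}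
    (hB : ExtCl (members E fun i => (k : ℕ) + 1 ≤ (i : ℕ)) B)
    (hT : ExtCl (members E fun i => (i : ℕ) < k) T) (h : Dist f g) :
    heartOrthogonal (hE.tilt k) (E k) X := by
  refine ⟨?_, fun a => ?_⟩
  · rw [hE.tilt_heart]
    exact mem_leftTilt hT (extCl_members_mono (fun i hi => by omega) hB) h
  · obtain ⟨l, rfl⟩ := h.lift a (TStructure.hom_eq_zero_of_heart (hE.stable k).heart
      (hE.members_le_heart _ _ hT) (by simp) _)
    rw [hE.hom_members_eq_zero (p := fun i => i = k) (fun i j hi hj => ?_) (extCl_member rfl) hB l,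
      zero_comp]
    subst hi
    exact Fin.lt_def.2 hj

/-- A torsion-free object for the first `k` stable objects is an extension of a torsion-free
object for the first `k + 1` stable objects by an object in the extension closure of the next. -/
theorem exists_dist_of_torsionFree (k : Fin m) {Y : D}
    (hY : ExtCl (members E fun i => (k : ℕ) ≤ (i : ℕ)) Y) :
    ∃ (A B : D) (f : A ⟶ Y) (g : Y ⟶ B), ExtensionClosure (E k) A ∧
      ExtCl (members E fun i => (k : ℕ) + 1 ≤ (i : ℕ)) B ∧ Dist f g := by
  obtain ⟨A, B, f, g, hA, hB, h⟩ := (hE.sortedFiltration (k := k) (hE.members_le_heart _ _ hY)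
    fun i hi a => hE.hom_members_eq_zero (p := fun j => j = i)
      (fun j l (hj : j = i) (hl : (k : ℕ) ≤ l) => Fin.lt_def.2 (by omega)) (extCl_member rfl) hY a).exists_dist
        ((k : ℕ) + 1)
  refine ⟨A, B, f, g, extensionClosure_iff.2 (hA.mono fun X ⟨i, hi, e⟩ => .of ?_), hB, h⟩
  obtain rfl : i = k := Fin.ext (by omega)
  exact e

omit hE [IsTriangulated D] in
theorem extensionClosure_le (k : Fin m) {X : D} (hX : ExtensionClosure (E k) X) :
    ExtCl (members E fun i => i = k) X :=
  (extensionClosure_iff.1 hX).mono fun _ e => .of ⟨k, rfl, e⟩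

/-- The part `A` of the torsion-free object `Y` built from `E k` is also a subobject of `X`. By the
octahedron its cokernel is an extension of T[-1] by `B`. -/
theorem isTorsionPair_tilt (k : Fin m) :
    IsTorsionPair (hE.tilt k) (ExtensionClosure (E k)) (heartOrthogonal (hE.tilt k) (E k)) where
  torsion_le X hX := hE.torsionFree_le_tilt k
    (extCl_members_mono (fun i hi => hi ▸ le_rfl) (extensionClosure_le k hX))
  torsionFree_le X hX := hX.1
  hom_eq_zero X Y hX hY f := (extensionClosure_iff.1 hX).hom_eq_zero_left
    (fun X ⟨e⟩ f => by rw [← cancel_epi e.inv, hY.2 (e.inv ≫ f), comp_zero]) f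
  exists_triangle X hX := by
    rw [hE.tilt_heart] at hX
    obtain ⟨T, Y, f, g, hT, hY, h⟩ := exists_dist_of_leftTilt hX
    obtain ⟨A, B, a, b, hA, hB, hab⟩ := hE.exists_dist_of_torsionFree k hY
    obtain ⟨Q, q, m₁, m₃, ⟨δ, h₁⟩, h₂, -, -⟩ := hab.octahedron h
    exact ⟨A, Q, hA, hE.mem_heartOrthogonal k hB hT h₂, _, _, δ, h₁⟩

/-- The torsion part `T` for k + 1 is cut into `T'`, torsion for `k`, and a quotient `F'` built from
`E k`. The fibre of X ⟶ F'[-1] is an extension of T'[-1] by `Y`, so it lies in the orthogonal. -/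
theorem tilt_succ_heart_le (k : Fin m) {X : D} (hX : (hE.tilt (k + 1)).heart X) :
    leftTilt (ExtensionClosure (E k)) (heartOrthogonal (hE.tilt k) (E k)) X := by
  rw [hE.tilt_heart] at hX
  obtain ⟨T, Y, f, g, hT, hY, h⟩ := exists_dist_of_leftTilt hX
  have hTh := hE.members_le_heart _ _ hT
  obtain ⟨T', F', a, b, hT', hF', hab⟩ := (hE.isTorsionPair k).exists_dist hTh
  obtain ⟨W, F'', c, d, hW, hF'', hcd⟩ := hE.exists_dist_of_torsionFree k hF'
  have hWh : t.heart W := hE.members_le_heart _ _ (extensionClosure_le k hW)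
  have hFh := hE.members_le_heart _ _ hF''
  have hbd : b ≫ d = 0 := (hE.isTorsionPair (k + 1)).hom_eq_zero _ _ hT hF'' _
  -- `F''` is a quotient of `T` lying in the torsion-free class for k + 1, so it vanishes and `F'`
  -- is built from `E k`.
  have hd : d = 0 := TStructure.eq_zero_of_comp_right hab (hE.members_le_heart _ _ hT') hFh hbd
  have h0 : IsZero F'' := by
    rw [IsZero.iff_id_eq_zero]
    exact TStructure.eq_zero_of_comp_right hcd hWh hFh (by rw [hd, zero_comp])
  have := hcd.isIso_left h0
  have hF : ExtensionClosure (E k) F' :=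
    extensionClosure_iff.2 ((extensionClosure_iff.1 hW).iso (asIso c))
  obtain ⟨a', b', hab'⟩ := hab.shift (-1)
  obtain ⟨V, p, m₁, m₃, h₁, h₂, -, -⟩ := h.octahedron' hab'
  exact mem_leftTilt hF (hE.mem_heartOrthogonal k hY hT' h₂) h₁

/-- Conversely, B ⟶ Y ⟶ X has a cone `Q` that is an extension of S[-1] by T[-1], so Q[1] is torsion
for k + 1; it remains to see that `B` is torsion-free for k + 1. -/
theorem le_tilt_succ_heart (k : Fin m) {X : D}
    (hX : leftTilt (ExtensionClosure (E k)) (heartOrthogonal (hE.tilt k) (E k)) X) :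
    (hE.tilt (k + 1)).heart X := by
  obtain ⟨S, Y, f, g, hS, hY, h⟩ := exists_dist_of_leftTilt hX
  have hYt := hY.1
  rw [hE.tilt_heart] at hYt
  obtain ⟨T, B, a, b, hT, hB, hab⟩ := exists_dist_of_leftTilt hYt
  have hB' : ExtCl (members E fun i => (k : ℕ) + 1 ≤ (i : ℕ)) B := by
    refine hE.torsionFree_of_hom_eq_zero (hE.members_le_heart _ _ hB) fun i hi l => ?_
    rcases Nat.lt_succ_iff_lt_or_eq.1 hi with hi | hi
    · exact (hE.isTorsionPair k).hom_eq_zero _ _ (extCl_member hi) hB l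
    -- For i = k: `B` is a subobject of `Y` in the tilted heart, and `Y` receives no nonzero map
    -- from `E k`.
    · obtain rfl := Fin.ext hi
      exact TStructure.eq_zero_of_comp_left hab (hE.torsion_shift_le_tilt i hT)
        (hE.isSimpleInHeart_tilt i).heart (hY.2 _)
  obtain ⟨Q, q, m₁, m₃, h₁, h₂, -, -⟩ := hab.octahedron h
  obtain ⟨r, s, h₃⟩ := h₂.shift 1
  have hQ : ExtCl (members E fun i => (i : ℕ) < k + 1) (Q⟦(1 : ℤ)⟧) :=
    .ext h₃ ((extCl_members_mono (fun i hi => by omega) hT).iso (shiftNegShift T (1 : ℤ)).symm)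
      ((extCl_members_mono (fun i hi => by omega) (extensionClosure_le k hS)).iso
        (shiftNegShift S (1 : ℤ)).symm)
  rw [hE.tilt_heart]
  exact mem_leftTilt hQ hB' (h₁.isoRight (shiftShiftNeg Q (1 : ℤ)).symm)

theorem isSimpleTilt (k : Fin m) : IsSimpleTilt (hE.tilt k) (hE.tilt (k + 1)) (E k) where
  simple := hE.isSimpleInHeart_tilt k
  torsionPair := hE.isTorsionPair_tilt k
  heart_eq := by
    ext X
    exact ⟨hE.tilt_succ_heart_le k, hE.le_tilt_succ_heart k⟩

theorem tilt_zero_heart : (hE.tilt 0).heart = t.heart := by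
  ext X
  refine ⟨fun hX => ?_, fun hX => hE.torsionFree_le_tilt 0
    (hE.torsionFree_of_hom_eq_zero hX fun i hi => absurd hi (Nat.not_lt_zero _))⟩
  rw [hE.tilt_heart] at hX
  obtain ⟨T, Y, f, g, hT, hY, h⟩ := exists_dist_of_leftTilt hX
  have := h.isIso_left ((shiftFunctor D (-1 : ℤ)).map_isZero
    (hT.isZero fun X ⟨i, hi, _⟩ => absurd hi (Nat.not_lt_zero _)))
  exact t.heart.prop_of_iso (asIso f) (hE.members_le_heart _ _ hY)

/-- No index is left for the torsion-free class, so it is zero and the torsion class is the whole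
heart. -/
theorem tilt_last_heart_iff (X : D) : (hE.tilt m).heart X ↔ t.heart (X⟦(1 : ℤ)⟧) := by
  have h0 : ∀ Y, ExtCl (members E fun i => m ≤ (i : ℕ)) Y → IsZero Y := fun Y hY =>
    hY.isZero fun X ⟨i, hi, _⟩ => absurd i.2 (not_lt.2 hi)
  refine ⟨fun hX => ?_, fun hX => ?_⟩
  · rw [hE.tilt_heart] at hX
    obtain ⟨T, Y, f, g, hT, hY, h⟩ := exists_dist_of_leftTilt hX
    have := h.isIso_right (h0 Y hY)
    exact t.heart.prop_of_iso ((shiftFunctor D (1 : ℤ)).mapIso (asIso g) ≪≫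
      shiftNegShift T (1 : ℤ)).symm (hE.members_le_heart _ _ hT)
  · exact (hE.tilt m).heart.prop_of_iso (shiftShiftNeg X (1 : ℤ)) (hE.torsion_shift_le_tilt m
      ((hE.isTorsionPair m).torsion_of_hom_eq_zero hX fun Y hY f => (h0 Y hY).eq_of_tgt _ _))

theorem isMaximalGreenSequence (ht : IsBoundedTStructure t) : IsMaximalGreenSequence t E :=
  ⟨fun k => hE.tilt k, {
    heart_zero := hE.tilt_zero_heart
    bounded := fun k => (hE.isTorsionPair k).tilt_isBounded ht
    algebraic := ⟨_, fun k => hE.isAlgebraicHeart_tilt ht k⟩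
    simpleTilt := hE.isSimpleTilt
    green := fun k => (hE.stable k).heart }, hE.tilt_last_heart_iff⟩

end IsStableSequence

end SimpleTilts

/-! ### Length of nilpotent modules over the preprojective algebra. -/

section NilpotentModules

variable {V : Type u} [Fintype V] [Quiver.{v} V] [∀ i j : V, Fintype (i ⟶ j)]

instance (i : V) : IsSimpleModule (PreprojectiveAlgebra V) (vertexSimple V i) := by
  have : Nontrivial (vertexSimple V i) := inferInstanceAs (Nontrivial ℂ)
  rw [isSimpleModule_iff_toSpanSingleton_surjective]
  refine ⟨this, fun x hx y => ?_⟩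
  have hx' : (show ℂ from x) ≠ 0 := hx
  refine ⟨algebraMap ℂ _ ((show ℂ from y) / (show ℂ from x)), ?_⟩
  change PreprojectiveAlgebra.vertexChar i (algebraMap ℂ _ ((show ℂ from y) / (show ℂ from x))) *
    (show ℂ from x) = (show ℂ from y)
  rw [AlgHom.commutes]
  exact div_mul_cancel₀ _ hx'

theorem isNilpotentModule_of_linearEquiv {N : Type w} [AddCommGroup N] [Module (PreprojectiveAlgebra V) N] {i : V}
    (e : N ≃ₗ[PreprojectiveAlgebra V] vertexSimple V i) : isNilpotentModule.{u, v, w} V (ModuleCat.of (PreprojectiveAlgebra V) N) := by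
  refine ⟨1, ![⊥, ⊤], rfl, rfl, fun k => ?_⟩
  obtain rfl : k = 0 := Subsingleton.elim _ _
  refine ⟨bot_le, i, ⟨?_⟩⟩
  change (↥(⊤ : Submodule (PreprojectiveAlgebra V) N) ⧸ (⊥ : Submodule (PreprojectiveAlgebra V) N).submoduleOf ⊤) ≃ₗ[PreprojectiveAlgebra V] vertexSimple V i
  exact Submodule.quotEquivOfEqBot _ (by
    rw [Submodule.submoduleOf, Submodule.comap_bot, Submodule.ker_subtype]) ≪≫ₗ
      Submodule.topEquiv ≪≫ₗ e

theorem exists_fin_transition {l : ℕ} {p : Fin (l + 1) → Prop} (h0 : ¬ p 0)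
    (hl : p (Fin.last l)) : ∃ k : Fin l, ¬ p k.castSucc ∧ p k.succ := by
  by_contra hcon
  push Not at hcon
  exact Fin.induction (motive := fun k => ¬ p k) h0 hcon (Fin.last l) hl

variable {M : ModuleCat.{w} (PreprojectiveAlgebra V)}

/-- A nonzero submodule of a nilpotent module contains a simple nilpotent module. -/
theorem exists_nilpotent_submodule (hM : isNilpotentModule V M) {N : Submodule (PreprojectiveAlgebra V) M}
    (hN : N ≠ ⊥) : ∃ N' ≤ N, N' ≠ ⊥ ∧ isNilpotentModule V (ModuleCat.of (PreprojectiveAlgebra V) N') := by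
  obtain ⟨l, F, h0, hl, hF⟩ := hM
  obtain ⟨k, hk, hk'⟩ := exists_fin_transition (p := fun k => N ⊓ F k ≠ ⊥) (by simp [h0])
    (by simpa [hl] using hN)
  rw [not_not] at hk
  obtain ⟨hle, i, ⟨e⟩⟩ := hF k
  refine ⟨N ⊓ F k.succ, inf_le_left, hk', ?_⟩
  let f : ↥(N ⊓ F k.succ) →ₗ[PreprojectiveAlgebra V] vertexSimple V i :=
    e.toLinearMap ∘ₗ Submodule.mkQ _ ∘ₗ Submodule.inclusion inf_le_right
  have hf : Function.Injective f := by
    rw [← LinearMap.ker_eq_bot, LinearMap.ker_eq_bot']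
    rintro ⟨x, hx⟩ hfx
    have h1 : Submodule.Quotient.mk (p := (F k.castSucc).submoduleOf (F k.succ))
        (⟨x, hx.2⟩ : F k.succ) = 0 := e.injective (hfx.trans e.map_zero.symm)
    rw [Submodule.Quotient.mk_eq_zero] at h1
    have h2 : x ∈ N ⊓ F k.castSucc := ⟨hx.1, h1⟩
    rw [hk] at h2
    exact Subtype.ext h2
  have hs : Function.Surjective f := by
    refine LinearMap.surjective_of_ne_zero fun h => hk' ?_
    rw [Submodule.eq_bot_iff]
    intro x hx
    have h1 : (⟨x, hx⟩ : ↥(N ⊓ F k.succ)) = 0 := hf (by rw [h]; simp)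
    exact congrArg Subtype.val h1
  exact isNilpotentModule_of_linearEquiv (LinearEquiv.ofBijective f ⟨hf, hs⟩)

/-- A proper submodule of a nilpotent module is contained in one with simple nilpotent
quotient. -/
theorem exists_nilpotent_quotient (hM : isNilpotentModule V M) {N : Submodule (PreprojectiveAlgebra V) M}
    (hN : N ≠ ⊤) : ∃ N', N ≤ N' ∧ N' ≠ ⊤ ∧ isNilpotentModule V (ModuleCat.of (PreprojectiveAlgebra V) (M ⧸ N')) := by
  obtain ⟨l, F, h0, hl, hF⟩ := hM
  obtain ⟨k, hk, hk'⟩ := exists_fin_transition (p := fun k => N ⊔ F k = ⊤)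
    (by simpa [h0] using hN) (by simp [hl])
  obtain ⟨hle, i, ⟨e⟩⟩ := hF k
  refine ⟨N ⊔ F k.castSucc, le_sup_left, hk, ?_⟩
  let q : (↥(F k.succ) ⧸ (F k.castSucc).submoduleOf (F k.succ)) →ₗ[PreprojectiveAlgebra V] M ⧸ (N ⊔ F k.castSucc) :=
    Submodule.liftQ _ (Submodule.mkQ _ ∘ₗ (F k.succ).subtype) fun x hx => by
      rw [LinearMap.mem_ker]
      exact (Submodule.Quotient.mk_eq_zero _).2 (Submodule.mem_sup_right hx)
  let f : vertexSimple V i →ₗ[PreprojectiveAlgebra V] M ⧸ (N ⊔ F k.castSucc) := q ∘ₗ e.symm.toLinearMap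
  have hs : Function.Surjective f := by
    intro y
    obtain ⟨x, rfl⟩ := Submodule.Quotient.mk_surjective _ y
    obtain ⟨a, ha, b, hb, rfl⟩ := Submodule.mem_sup.1
      (hk'.symm ▸ Submodule.mem_top : x ∈ N ⊔ F k.succ)
    refine ⟨e (Submodule.Quotient.mk ⟨b, hb⟩), ?_⟩
    change q (e.symm (e _)) = _
    rw [e.symm_apply_apply]
    change Submodule.Quotient.mk b = _
    rw [Submodule.Quotient.eq]
    refine Submodule.mem_sup_left ?_
    rw [show b - (a + b) = -a by abel]
    exact N.neg_mem ha
  have hi : Function.Injective f := by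
    refine LinearMap.injective_of_ne_zero fun h => hk ?_
    rw [← Submodule.Quotient.subsingleton_iff]
    refine ⟨fun x y => ?_⟩
    obtain ⟨x, rfl⟩ := hs x
    obtain ⟨y, rfl⟩ := hs y
    simp [h]
  exact isNilpotentModule_of_linearEquiv (LinearEquiv.ofBijective f ⟨hi, hs⟩).symm

theorem isNoetherian_and_isArtinian (hM : isNilpotentModule V M) :
    IsNoetherian (PreprojectiveAlgebra V) M ∧ IsArtinian (PreprojectiveAlgebra V) M := by
  obtain ⟨l, F, h0, hl, hF⟩ := hM
  have key : ∀ k, IsNoetherian (PreprojectiveAlgebra V) (F k) ∧ IsArtinian (PreprojectiveAlgebra V) (F k) := by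
    intro k
    induction k using Fin.induction with
    | zero =>
      rw [h0]
      exact ⟨inferInstance, inferInstance⟩
    | succ k ih =>
      obtain ⟨hle, i, ⟨e⟩⟩ := hF k
      have := ih.1
      have := ih.2
      let e' := Submodule.submoduleOfEquivOfLe hle
      exact ⟨(isNoetherian_iff_submodule_quotient _).2
          ⟨isNoetherian_of_linearEquiv e'.symm, isNoetherian_of_linearEquiv e.symm⟩,
        (isArtinian_iff_submodule_quotient _).2
          ⟨isArtinian_of_linearEquiv e'.symm, isArtinian_of_linearEquiv e.symm⟩⟩
  have h := key (Fin.last l)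
  rw [hl] at h
  have := h.1
  have := h.2
  exact ⟨isNoetherian_of_linearEquiv Submodule.topEquiv,
    isArtinian_of_linearEquiv Submodule.topEquiv⟩

namespace PreprojectiveNil

variable {X Y : PreprojectiveNil.{u, v, w} V} (f : X ⟶ Y)

/-- A monomorphism of the full subcategory is only tested on nilpotent modules, so a nonzero kernel
is refuted by a simple nilpotent submodule of it. The case of epimorphisms is dual. -/
theorem injective_of_mono [Mono f] : Function.Injective f.hom.hom := by
  rw [← LinearMap.ker_eq_bot]
  by_contra h
  obtain ⟨N, hN, hN0, hNil⟩ := exists_nilpotent_submodule X.2 h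
  let Z : PreprojectiveNil.{u, v, w} V := ⟨ModuleCat.of (PreprojectiveAlgebra V) N, hNil⟩
  let i : Z ⟶ X := (isNilpotentModule V).homMk (ModuleCat.ofHom N.subtype)
  have hi : i = 0 := by
    rw [← cancel_mono f, zero_comp]
    ext x
    exact hN x.2
  refine hN0 ((Submodule.eq_bot_iff _).2 fun x hx => ?_)
  exact congrArg (fun j : Z ⟶ X => j.hom.hom ⟨x, hx⟩) hi

theorem surjective_of_epi [Epi f] : Function.Surjective f.hom.hom := by
  rw [← LinearMap.range_eq_top]
  by_contra h
  obtain ⟨N, hN, hN0, hNil⟩ := exists_nilpotent_quotient Y.2 h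
  let Z : PreprojectiveNil.{u, v, w} V := ⟨ModuleCat.of (PreprojectiveAlgebra V) (Y.obj ⧸ N), hNil⟩
  let p : Y ⟶ Z := (isNilpotentModule V).homMk (ModuleCat.ofHom N.mkQ)
  have hp : p = 0 := by
    rw [← cancel_epi f, comp_zero]
    ext x
    exact (Submodule.Quotient.mk_eq_zero _).2 (hN ⟨x, rfl⟩)
  refine hN0 ((Submodule.eq_top_iff').2 fun x => ?_)
  rw [← Submodule.Quotient.mk_eq_zero]
  exact congrArg (fun j : Y ⟶ Z => j.hom.hom x) hp

theorem isIso_of_bijective (h : Function.Bijective f.hom.hom) : IsIso f := by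
  have : IsIso f.hom := (ConcreteCategory.isIso_iff_bijective f.hom).2 h
  have : IsIso ((isNilpotentModule V).ι.map f) := this
  exact isIso_of_reflects_iso f (isNilpotentModule V).ι

/-- The length of a nilpotent module. -/
def length (X : PreprojectiveNil.{u, v, w} V) : ℕ := (Module.length (PreprojectiveAlgebra V) X.obj).toNat

theorem length_lt_of_mono [Mono f] (hf : ¬ IsIso f) : length X < length Y := by
  obtain ⟨_, _⟩ := isNoetherian_and_isArtinian X.2
  obtain ⟨_, _⟩ := isNoetherian_and_isArtinian Y.2
  have hi := injective_of_mono f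
  rw [length, length, ← Nat.cast_lt (α := ℕ∞), ENat.natCast_toNat Module.length_ne_top,
    ENat.natCast_toNat Module.length_ne_top,
    (LinearEquiv.ofInjective _ hi).length_eq]
  refine Submodule.length_lt fun h => hf (isIso_of_bijective f ⟨hi, ?_⟩)
  exact LinearMap.range_eq_top.1 h

theorem length_lt_of_epi [Epi f] (hf : ¬ IsIso f) : length Y < length X := by
  obtain ⟨_, _⟩ := isNoetherian_and_isArtinian X.2
  obtain ⟨_, _⟩ := isNoetherian_and_isArtinian Y.2
  have hs := surjective_of_epi f
  rw [length, length, ← Nat.cast_lt (α := ℕ∞), ENat.natCast_toNat Module.length_ne_top,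
    ENat.natCast_toNat Module.length_ne_top,
    ← (LinearMap.quotKerEquivOfSurjective _ hs).length_eq]
  refine Submodule.length_quotient_lt _ fun h => hf (isIso_of_bijective f ⟨?_, hs⟩)
  exact LinearMap.ker_eq_bot.1 h

end PreprojectiveNil

end NilpotentModules

/-! ### From the abelian category to the heart: classes, charges and stability. -/

section HeartTransfer

variable {D : Type u} [Category.{v} D] [Preadditive D] [HasZeroObject D] [HasShift D ℤ]
  [∀ n : ℤ, (shiftFunctor D n).Additive] [Pretriangulated D]
  {A : Type u'} [Category.{v'} A] [Preadditive A] (t : TStructure D) [t.Heart A]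

namespace CategoryTheory.Triangulated.TStructure

theorem isZero_ιHeart_iff (X : A) : IsZero (t.ιHeart.obj X) ↔ IsZero X := by
  rw [IsZero.iff_id_eq_zero, IsZero.iff_id_eq_zero]
  constructor
  · intro h
    apply t.ιHeart.map_injective
    rw [Functor.map_id, h, Functor.map_zero]
  · intro h
    rw [← Functor.map_id, h, Functor.map_zero]

/-- Triangles in the heart come from morphisms of `A`. -/
theorem exists_dist_ιHeart {X Y Z : D} {f : X ⟶ Y} {g : Y ⟶ Z} (h : Dist f g) {x y z : A}
    (ex : t.ιHeart.obj x ≅ X) (ey : t.ιHeart.obj y ≅ Y) (ez : t.ιHeart.obj z ≅ Z) :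
    ∃ (i : x ⟶ y) (p : y ⟶ z), Dist (t.ιHeart.map i) (t.ιHeart.map p) ∧
      t.ιHeart.map i = ex.hom ≫ f ≫ ey.inv ∧ t.ιHeart.map p = ey.hom ≫ g ≫ ez.inv :=
  ⟨t.ιHeart.preimage (ex.hom ≫ f ≫ ey.inv), t.ιHeart.preimage (ey.hom ≫ g ≫ ez.inv),
    h.of_iso ex ey ez (by simp) (by simp), by simp, by simp⟩

variable {t} in
theorem mono_of_dist {x y : A} {i : x ⟶ y} {Z : D} {g : t.ιHeart.obj y ⟶ Z}
    (h : Dist (t.ιHeart.map i) g) (hZ : t.heart Z) : Mono i :=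
  Preadditive.mono_of_cancel_zero _ fun {w} k hk => by
    apply t.ιHeart.map_injective
    rw [Functor.map_zero]
    refine eq_zero_of_comp_left h hZ (t.ιHeart_obj_mem w) ?_
    rw [← Functor.map_comp, hk, Functor.map_zero]

variable {t} in
theorem epi_of_dist {y z : A} {p : y ⟶ z} {X : D} {f : X ⟶ t.ιHeart.obj y}
    (h : Dist f (t.ιHeart.map p)) (hX : t.heart X) : Epi p :=
  Preadditive.epi_of_cancel_zero _ fun {w} k hk => by
    apply t.ιHeart.map_injective
    rw [Functor.map_zero]
    refine eq_zero_of_comp_right h hX (t.ιHeart_obj_mem w) ?_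
    rw [← Functor.map_comp, hk, Functor.map_zero]

variable (A) in
/-- A function on the objects of `A`, as a function on the objects of the heart. -/
def extendHeart {G : Type w} [Zero G] (f : A → G) (X : D) : G :=
  open scoped Classical in
  if h : t.heart X then f (t.exists_iso_ιHeart A h).choose else 0

theorem exists_extendHeart_eq {G : Type w} [Zero G] (f : A → G) {X : D} (hX : t.heart X) :
    ∃ a : A, Nonempty (t.ιHeart.obj a ≅ X) ∧ t.extendHeart A f X = f a :=
  ⟨_, (t.exists_iso_ιHeart A hX).choose_spec, by rw [extendHeart, dif_pos hX]⟩

end CategoryTheory.Triangulated.TStructure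

variable [IsTriangulated D]

/-- The triangle exhibits `f` as a kernel of `g`, with `g` an epimorphism, so it is a short exact
sequence of `A` and gives a defining relation. -/
theorem GrothendieckK.cls_of_dist {X Y Z : A} {f : X ⟶ Y} {g : Y ⟶ Z}
    (h : Dist (t.ιHeart.map f) (t.ιHeart.map g)) :
    GrothendieckK.cls Y = GrothendieckK.cls X + GrothendieckK.cls Z := by
  obtain ⟨k, hk⟩ := h
  have := t.mono_of_dist (A := A) ⟨k, hk⟩ (t.ιHeart_obj_mem Z)
  have := t.epi_of_dist (A := A) ⟨k, hk⟩ (t.ιHeart_obj_mem X)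
  have := t.hasFiniteProducts_heart A
  have hker := AbelianSubcategory.isLimitKernelForkOfDistTriang t.ιHeart_hom_eq_zero f g k hk
  have w : f ≫ g = 0 := by
    apply t.ιHeart.map_injective
    rw [Functor.map_comp, Functor.map_zero]
    exact Dist.comp_eq_zero ⟨k, hk⟩
  let := t.heartAbelian A
  let S := ShortComplex.mk f g w
  have hS : S.ShortExact := { exact := S.exact_of_f_is_kernel hker }
  have h0 : (QuotientAddGroup.mk (FreeAbelianGroup.of Y - FreeAbelianGroup.of X -
      FreeAbelianGroup.of Z) : GrothendieckK A) = 0 :=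
    (QuotientAddGroup.eq_zero_iff _).2 (AddSubgroup.subset_closure ⟨S, hS, rfl⟩)
  have h1 : GrothendieckK.cls Y - GrothendieckK.cls X - GrothendieckK.cls Z = 0 := h0
  rw [sub_sub, sub_eq_zero] at h1
  exact h1

include t in
theorem GrothendieckK.cls_of_iso {X Y : A} (e : X ≅ Y) :
    GrothendieckK.cls X = GrothendieckK.cls Y := by
  obtain ⟨O, ⟨eO⟩⟩ := t.exists_iso_ιHeart A (t.heart_of_isZero (isZero_zero D))
  have hO : IsZero (t.ιHeart.obj O) := (isZero_zero D).of_iso eO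
  have h1 : (GrothendieckK.cls O : GrothendieckK A) = 0 := by
    have h := Dist.id_zero (t.ιHeart.obj O) hO
    rw [← t.ιHeart.map_id, ← t.ιHeart.map_zero] at h
    have := GrothendieckK.cls_of_dist t h
    rwa [left_eq_add] at this
  have h := Dist.of_isIso_left (t.ιHeart.map e.hom) hO
  rw [← t.ιHeart.map_zero] at h
  rw [GrothendieckK.cls_of_dist t h, h1, add_zero]

theorem isHeartAdditive_extendHeart {G : Type w} [AddCommGroup G] (φ : GrothendieckK A →+ G) :
    IsHeartAdditive t (t.extendHeart A fun X => φ (GrothendieckK.cls X)) := by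
  intro X Y Z f g hX hZ h
  obtain ⟨x, ⟨ex⟩, hx⟩ := t.exists_extendHeart_eq (fun X : A => φ (GrothendieckK.cls X)) hX
  obtain ⟨y, ⟨ey⟩, hy⟩ := t.exists_extendHeart_eq (fun X : A => φ (GrothendieckK.cls X))
    (t.heart_of_dist h hX hZ)
  obtain ⟨z, ⟨ez⟩, hz⟩ := t.exists_extendHeart_eq (fun X : A => φ (GrothendieckK.cls X)) hZ
  obtain ⟨i, p, hd, -⟩ := t.exists_dist_ιHeart h ex ey ez
  rw [hx, hy, hz, GrothendieckK.cls_of_dist t hd, map_add]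

theorem arg_pos_of_mem_closedUpperHalfPlane {z : ℂ} (hz : z ∈ closedUpperHalfPlane) :
    0 < z.arg := by
  obtain ⟨r, φ, hr, hφ, hφ1, rfl⟩ := hz
  have hpi := Real.pi_pos
  rw [show Complex.I * Real.pi * φ = ((Real.pi * φ : ℝ) : ℂ) * Complex.I by push_cast; ring,
    Complex.exp_mul_I, Complex.arg_mul_cos_add_sin_mul_I hr ⟨by nlinarith, by nlinarith⟩]
  positivity

omit [IsTriangulated D] in
theorem IsStableInHeart.iso {t : TStructure D} {z : D → ℂ} (hz : IsTriangleAdditive z) {X Y : D}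
    (hX : IsStableInHeart t z X) (e : X ≅ Y) : IsStableInHeart t z Y where
  heart := t.heart.prop_of_iso e hX.heart
  not_isZero h := hX.not_isZero (h.of_iso e)
  arg_lt _ _ _ _ hA hB h hA0 hB0 := by
    rw [← hz.map_iso e]
    exact hX.arg_lt hA hB (h.isoMiddle e.symm) hA0 hB0

namespace CentralCharge

variable {t} {Z : CentralCharge A} {z : D → ℂ}

include t in
theorem phase_of_iso {X Y : A} (e : X ≅ Y) : Z.phase X = Z.phase Y := by
  rw [phase, phase, GrothendieckK.cls_of_iso t e]

omit [IsTriangulated D] in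
theorem phase_lt_phase_iff (hz : ∀ X : A, z (t.ιHeart.obj X) = Z.hom (GrothendieckK.cls X))
    {X Y : A} : Z.phase X < Z.phase Y ↔
      (z (t.ιHeart.obj X)).arg < (z (t.ιHeart.obj Y)).arg := by
  rw [phase, phase, div_lt_div_iff_of_pos_right Real.pi_pos, hz, hz]

/-- A triangle P ⟶ X ⟶ B of the heart is a subobject of `X` in `A`, proper exactly because `B` is
nonzero. -/
theorem isStableInHeart_of_isStable (hadd : IsTriangleAdditive z)
    (hz : ∀ X : A, z (t.ιHeart.obj X) = Z.hom (GrothendieckK.cls X)) {X : A}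
    (hX : Z.IsStable X) : IsStableInHeart t z (t.ιHeart.obj X) := by
  refine ⟨t.ιHeart_obj_mem X, fun h => hX.1 ((t.isZero_ιHeart_iff X).1 h),
    fun P B f g hP hB h hP0 hB0 => ?_⟩
  obtain ⟨p, ⟨ep⟩⟩ := t.exists_iso_ιHeart A hP
  obtain ⟨i, hi⟩ := t.ιHeart.map_surjective (ep.hom ≫ f)
  have hd : Dist (t.ιHeart.map i) g := hi ▸ h.isoLeft ep
  have := t.mono_of_dist hd hB
  let e := Subobject.underlyingIso i
  have hlt := hX.2 (Subobject.mk i)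
    (fun h0 => hP0 (((t.isZero_ιHeart_iff p).2 (h0.of_iso e.symm)).of_iso ep.symm))
    (fun htop => hB0 (hd.isZero_right (by
      have := (Subobject.isIso_iff_mk_eq_top i).2 htop
      infer_instance)))
  rwa [phase_of_iso (t := t) e, phase_lt_phase_iff hz, hadd.map_iso ep] at hlt

omit [IsTriangulated D] in
theorem isStable_of_isStableInHeart
    (hz : ∀ X : A, z (t.ιHeart.obj X) = Z.hom (GrothendieckK.cls X)) {X : A}
    (hX : IsStableInHeart t z (t.ιHeart.obj X)) : Z.IsStable X := by
  refine ⟨fun h => hX.not_isZero ((t.isZero_ιHeart_iff X).2 h), fun Y hY0 hY => ?_⟩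
  obtain ⟨Q, p, hQ, hd⟩ := t.exists_dist_of_mono Y.arrow
  rw [phase_lt_phase_iff hz]
  refine hX.arg_lt (t.ιHeart_obj_mem _) hQ hd (fun h => hY0 ((t.isZero_ιHeart_iff _).1 h))
    fun hQ0 => hY ?_
  have := hd.isIso_left hQ0
  have : IsIso Y.arrow := isIso_of_reflects_iso _ t.ιHeart
  exact Subobject.eq_top_of_isIso_arrow Y

/-- A listing of the stable objects of `A` gives a stable sequence in the heart. -/
theorem IsStableListing.exists_isStableSequence (ht : IsBoundedTStructure t) (len : A → ℕ)
    (hmono : ∀ ⦃X Y : A⦄ (f : X ⟶ Y), Mono f → ¬ IsIso f → len X < len Y)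
    (hepi : ∀ ⦃X Y : A⦄ (f : X ⟶ Y), Epi f → ¬ IsIso f → len Y < len X) {m : ℕ} {E : Fin m → A}
    (hE : Z.IsStableListing E) :
    ∃ z μ, IsStableSequence t z μ (fun k => t.ιHeart.obj (E k)) := by
  -- The central charge becomes a function on `D` as an Euler characteristic, so that shifted
  -- objects have charges too.
  obtain ⟨z, hadd, hz'⟩ := (isHeartAdditive_extendHeart (A := A) t Z.hom).exists_extension ht
  have hz : ∀ X : A, z (t.ιHeart.obj X) = Z.hom (GrothendieckK.cls X) := fun X => by
    obtain ⟨a, ⟨e⟩, ha⟩ := t.exists_extendHeart_eq (fun X : A => Z.hom (GrothendieckK.cls X))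
      (t.ιHeart_obj_mem X)
    rw [hz' _ (t.ιHeart_obj_mem X), ha, GrothendieckK.cls_of_iso t (t.ιHeart.preimageIso e)]
  refine ⟨z, t.extendHeart A len, hadd, fun X hX hX0 => ?_, fun X Y Z f g hX hZ h hZ0 => ?_,
    fun X Y Z f g hX hZ h hX0 => ?_, fun k => isStableInHeart_of_isStable hadd hz (hE.isStable k),
    fun X hX => ?_, fun j k hjk => ?_⟩
  · obtain ⟨x, ⟨e⟩⟩ := t.exists_iso_ιHeart A hX
    rw [← hadd.map_iso e, hz]
    exact arg_pos_of_mem_closedUpperHalfPlane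
      (Z.hom_mem x fun h0 => hX0 (((t.isZero_ιHeart_iff x).2 h0).of_iso e.symm))
  · obtain ⟨x, ⟨ex⟩, hx⟩ := t.exists_extendHeart_eq len hX
    obtain ⟨y, ⟨ey⟩, hy⟩ := t.exists_extendHeart_eq len (t.heart_of_dist h hX hZ)
    obtain ⟨z, ⟨ez⟩⟩ := t.exists_iso_ιHeart A hZ
    obtain ⟨i, p, hd, -⟩ := t.exists_dist_ιHeart h ex ey ez
    rw [hx, hy]
    refine hmono i (t.mono_of_dist hd (t.ιHeart_obj_mem z)) fun hi => hZ0 ?_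
    exact (hd.isZero_right inferInstance).of_iso ez.symm
  · obtain ⟨x, ⟨ex⟩⟩ := t.exists_iso_ιHeart A hX
    obtain ⟨y, ⟨ey⟩, hy⟩ := t.exists_extendHeart_eq len (t.heart_of_dist h hX hZ)
    obtain ⟨z, ⟨ez⟩, hz⟩ := t.exists_extendHeart_eq len hZ
    obtain ⟨i, p, hd, -⟩ := t.exists_dist_ιHeart h ex ey ez
    rw [hy, hz]
    refine hepi p (t.epi_of_dist hd (t.ιHeart_obj_mem x)) fun hp => hX0 ?_
    exact (hd.isZero_left inferInstance).of_iso ex.symm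
  · obtain ⟨x, ⟨e⟩⟩ := t.exists_iso_ιHeart A hX.heart
    obtain ⟨k, ⟨e'⟩⟩ := hE.exhaustive x (isStable_of_isStableInHeart hz (hX.iso hadd e.symm))
    exact ⟨k, ⟨e.symm ≪≫ t.ιHeart.mapIso e'⟩⟩
  · exact (phase_lt_phase_iff hz).1 (hE.phase_strictAnti hjk)

include t in
theorem exists_isStableListing (hdiscrete : Z.IsDiscrete) (hfinite : Z.HasFinitelyManyStables) :
    ∃ (m : ℕ) (E : Fin m → A), Z.IsStableListing E := by
  obtain ⟨n, S, hS⟩ := hfinite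
  have hfin : {r : ℝ | ∃ X, Z.IsStable X ∧ Z.phase X = r}.Finite := by
    refine (Set.finite_range fun k => Z.phase (S k)).subset ?_
    rintro r ⟨X, hX, rfl⟩
    obtain ⟨k, ⟨e⟩⟩ := hS X hX
    exact ⟨k, (phase_of_iso (t := t) e).symm⟩
  let φ := hfin.toFinset.orderIsoOfFin rfl
  -- `φ` lists the phases in increasing order, and `rev` makes them decrease. Discreteness ensures
  -- that one stable object per phase suffices.
  have hφ : ∀ k : Fin hfin.toFinset.card, ∃ X, Z.IsStable X ∧ Z.phase X = φ k.rev := fun k =>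
    hfin.mem_toFinset.1 (φ k.rev).2
  choose E hE hEφ using hφ
  refine ⟨_, E, hE, fun X hX => ?_, fun j k hjk => ?_⟩
  · obtain ⟨k, hk⟩ := φ.surjective ⟨Z.phase X, hfin.mem_toFinset.2 ⟨X, hX, rfl⟩⟩
    refine ⟨k.rev, hdiscrete _ _ hX (hE _) ?_⟩
    rw [hEφ, Fin.rev_rev, hk]
  · dsimp only
    rw [hEφ, hEφ]
    exact φ.strictMono (Fin.rev_lt_rev.2 hjk)

end CentralCharge

end HeartTransfer

end

/-- The module category enters the second part only through its length function, which decreases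
strictly on proper subobjects and quotients. -/
theorem mainTheorem8
    {V : Type u} [Fintype V] [Quiver.{v} V] [∀ i j : V, Fintype (i ⟶ j)]
    (hloop : ∀ i : V, IsEmpty (i ⟶ i))
    (Z : CentralCharge (PreprojectiveNil.{u, v, w} V))
    (hdiscrete : Z.IsDiscrete) (hfinite : Z.HasFinitelyManyStables)
    {D : Type u'} [Category.{v'} D] [Preadditive D] [HasZeroObject D] [HasShift D ℤ]
    [∀ n : ℤ, (shiftFunctor D n).Additive] [Pretriangulated D] [IsTriangulated D]
    (t : TStructure D) (ht : IsBoundedTStructure t) [t.Heart (PreprojectiveNil.{u, v, w} V)] :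
    (∃ (m : ℕ) (E : Fin m → PreprojectiveNil.{u, v, w} V), Z.IsStableListing E) ∧
    ∀ (m : ℕ) (E : Fin m → PreprojectiveNil.{u, v, w} V), Z.IsStableListing E →
      IsMaximalGreenSequence t (fun k => t.ιHeart.obj (E k)) := by
  refine ⟨CentralCharge.exists_isStableListing (t := t) hdiscrete hfinite, fun m E hE => ?_⟩
  obtain ⟨z, μ, h⟩ := hE.exists_isStableSequence ht PreprojectiveNil.length
    (fun _ _ f _ hf => PreprojectiveNil.length_lt_of_mono f hf)
    (fun _ _ f _ hf => PreprojectiveNil.length_lt_of_epi f hf)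
  exact h.isMaximalGreenSequence ht
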